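/- **Setting.** Let $d\ge 1$, $\delta>0$, $\varepsilon>0$, and let $\Omega\subset\mathbb R^d$ be open and bounded. Put $\Omega_{\mathcal I_\delta}=\{x\in\mathbb R^d\setminus\Omega:\operatorname{dist}(x,\partial\Omega)<\delta\}$ and $\Omega_\delta=\Omega\cup\Omega_{\mathcal I_\delta}$. Let $\gamma^{\rm diff}:(0,1]\to[0,\infty)$ be non-increasing with $\int_{B_1(0)}\gamma^{\rm diff}(|s|)|s|^2\,ds=d$. For a given $\eta>0$ put $\gamma^{\rm conv}(r)=\frac r\eta\,\gamma^{\rm diff}(r)$; extend both kernels by $0$ to $r>1$, and put $\gamma^{\rm diff}_\delta(r)=\delta^{-d-2}\gamma^{\rm diff}(r/\delta)$, $\gamma^{\rm conv}_\delta(r)=\delta^{-d-1}\gamma^{\rm conv}(r/\delta)$. For a velocity field $\mathbf b:\mathbb R^d\to\mathbb R^d$ and influence regions $\mathcal H_\delta(x)\subset B_\delta(x)$ define $$\mathcal G_\delta u(x)=\int_{\mathcal H_\delta(x)}\frac{y-x}{|y-x|}\,\gamma_\delta^{\rm conv}(|y-x|)\,(u(y)-u(x))\,dy,$$ $$\mathcal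 D_\delta(\mathbf b)(x)=\mathrm{p.v.}\!\int_{\mathbb R^d}\bigl(\mathbf b(x)1_{\mathcal H_\delta(x)}(y)+\mathbf b(y)1_{\mathcal H_\delta(y)}(x)\bigr)\cdot\frac{y-x}{|y-x|}\,\gamma^{\rm conv}_\delta(|y-x|)\,dy,$$ where the principal value is the limit, as $r\downarrow0$, of the integrals over $\{|y-x|>r\}$. Let $$a(u,v)=\int_{\Omega_\delta}\int_{\Omega_\delta}\gamma^{\rm diff}_\delta(|y-x|)(u(y)-u(x))(v(y)-v(x))\,dy\,dx,$$ let $\mathcal S_\delta(\Omega)$ be the space of all $u\in L^2(\Omega_\delta)$ with $a(u,u)<\infty$ and $u=0$ a.e. on $\Omega_{\mathcal I_\delta}$, and let $$b(u,v)=\varepsilon\,a(u,v)+\int_\Omega \mathbf b(x)\cdot\mathcal G_\delta u(x)\,v(x)\,dx\qquad(u,v\in\mathcal S_\delta(\Omega)).$$ Assume one of the following. 1. $\mathbf b$ is constant, $\mathcal H_\delta(x)=B_\delta(x)$ for all $x$, and $\eta=1$. 2. $\mathbf b\in L^\infty(\mathbb R^d;\mathbb R^d)$, $\mathcal H_\delta(x)=\{y\in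 B_\delta(x): -\mathbf b(x)\cdot(y-x)>0\}$ for all $x$, $\eta=\frac12$, and for a.e. $x\in\Omega$ the principal value $\mathcal D_\delta(\mathbf b)(x)$ exists and $-\mathcal D_\delta(\mathbf b)(x)\ge0$. **Theorem.** The energy norm $\|u\|_U=a(u,u)^{1/2}$ is a norm on $U=\mathcal S_\delta(\Omega)$, and $\|v\|_{{\rm opt},V}=\sup_{u\in U}\frac{|b(u,v)|}{\|u\|_U}$ is finite for every $v$ and is a norm on $V=\mathcal S_\delta(\Omega)$ (here and below $0/0=0$). For every linear functional $f_\delta$ on $V$ that is continuous for $\|\cdot\|_{{\rm opt},V}$ there is exactly one $u\in U$ with $b(u,v)=f_\delta(v)$ for all $v\in V$, and it satisfies $$\|u\|_U=\|f_\delta\|_{V^*}:=\sup_{v\in V}\frac{|f_\delta(v)|}{\|v\|_{{\rm opt},V}}.$$ -/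

import Mathlib

open MeasureTheory Set Filter Topology
open scoped ENNReal RealInnerProductSpace

noncomputable section

namespace NonlocalCD

/-- The Euclidean space of dimension `d`. -/
abbrev Space (d : ℕ) : Type := EuclideanSpace ℝ (Fin d)

/-- A diffusion kernel profile on the unit interval: non-negative, non-increasing, and normalized so
that `∫_{B_1(0)} γ(|s|) |s|² ds = d`. The profile may blow up at `0` (its value at the single point
`0` is never used), so the sign and monotonicity conditions are stated on `(0, 1]`. -/
structure DiffusionKernel (d : ℕ) where
  toFun : ℝ → ℝ
  nonneg : ∀ r ∈ Ioc (0 : ℝ) 1, 0 ≤ toFun r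
  antitone : AntitoneOn toFun (Ioc (0 : ℝ) 1)
  moment : ∫ s in Metric.ball (0 : Space d) 1, toFun ‖s‖ * ‖s‖ ^ 2 = (d : ℝ)

namespace DiffusionKernel

variable {d : ℕ}

/-- The kernel profile extended by zero outside `(0, 1]`. -/
def profile (γ : DiffusionKernel d) : ℝ → ℝ := indicator (Ioc (0 : ℝ) 1) γ.toFun

/-- The rescaled diffusion kernel `γ_δ^diff(r) = δ^{-(d+2)} γ^diff(r / δ)`. -/
def diff (γ : DiffusionKernel d) (δ r : ℝ) : ℝ := 1 / δ ^ (d + 2) * γ.profile (r / δ)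

/-- The convection kernel profile `γ^conv(r) = (r / η) γ^diff(r)`. -/
def convProfile (γ : DiffusionKernel d) (η r : ℝ) : ℝ := r / η * γ.profile r

/-- The rescaled convection kernel `γ_δ^conv(r) = δ^{-(d+1)} γ^conv(r / δ)`. -/
def conv (γ : DiffusionKernel d) (η δ r : ℝ) : ℝ := 1 / δ ^ (d + 1) * γ.convProfile η (r / δ)

theorem measurable_profile (γ : DiffusionKernel d) : Measurable γ.profile := by
  refine measurable_of_Ioi fun a => ?_
  rcases lt_or_ge a 0 with ha | ha
  · have : γ.profile ⁻¹' Ioi a = univ := by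
      refine eq_univ_of_forall fun r => lt_of_lt_of_le ha ?_
      exact indicator_nonneg γ.nonneg r
    rw [this]
    exact MeasurableSet.univ
  · refine OrdConnected.measurableSet ⟨fun x hx y hy z hz => ?_⟩
    have key : ∀ r, r ∈ γ.profile ⁻¹' Ioi a → r ∈ Ioc (0 : ℝ) 1 ∧ a < γ.toFun r := by
      intro r hr
      have hr' : a < indicator (Ioc (0 : ℝ) 1) γ.toFun r := hr
      by_cases h : r ∈ Ioc (0 : ℝ) 1
      · rw [indicator_of_mem h] at hr'
        exact ⟨h, hr'⟩
      · rw [indicator_of_notMem h] at hr'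
        exact absurd hr' (not_lt.2 ha)
    obtain ⟨hx1, -⟩ := key x hx
    obtain ⟨hy1, hy2⟩ := key y hy
    have hz1 : z ∈ Ioc (0 : ℝ) 1 := ⟨hx1.1.trans_le hz.1, hz.2.trans hy1.2⟩
    change a < indicator (Ioc (0 : ℝ) 1) γ.toFun z
    rw [indicator_of_mem hz1]
    exact hy2.trans_le (γ.antitone hz1 hy1 hz.2)

theorem measurable_diff (γ : DiffusionKernel d) (δ : ℝ) : Measurable (γ.diff δ) :=
  (γ.measurable_profile.comp (measurable_id.div_const δ)).const_mul _

end DiffusionKernel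

variable {d : ℕ}

/-- The interaction domain: the points outside `Ω` at distance less than `δ` from `∂Ω`. -/
def interactionDomain (δ : ℝ) (Ω : Set (Space d)) : Set (Space d) :=
  Metric.thickening δ (frontier Ω) \ Ω

/-- `Ω_δ`, the union of `Ω` and its interaction domain. -/
def extendedDomain (δ : ℝ) (Ω : Set (Space d)) : Set (Space d) :=
  Ω ∪ interactionDomain δ Ω

/-- The integrand of the energy. -/
def energyDensity (γ : DiffusionKernel d) (δ : ℝ) (u : Space d → ℝ) (x y : Space d) : ℝ≥0∞ :=
  ENNReal.ofReal (γ.diff δ ‖y - x‖ * (u y - u x) ^ 2)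

theorem measurable_energyDensity (γ : DiffusionKernel d) (δ : ℝ) {u : Space d → ℝ}
    (hu : Measurable u) : Measurable (Function.uncurry (energyDensity γ δ u)) := by
  have h1 : Measurable fun p : Space d × Space d => γ.diff δ ‖p.2 - p.1‖ :=
    (γ.measurable_diff δ).comp (measurable_snd.sub measurable_fst).norm
  exact (h1.mul (((hu.comp measurable_snd).sub (hu.comp measurable_fst)).pow_const 2)).ennreal_ofReal

theorem energyDensity_add_le (γ : DiffusionKernel d) (δ : ℝ) (u v : Space d → ℝ) (x y : Space d) :
    energyDensity γ δ (u + v) x y ≤ 2 * energyDensity γ δ u x y + 2 * energyDensity γ δ v x y := by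
  unfold energyDensity
  have two : ∀ t : ℝ, 2 * ENNReal.ofReal t = ENNReal.ofReal (2 * t) := fun t => by
    rw [ENNReal.ofReal_mul (by norm_num), ENNReal.ofReal_ofNat]
  rcases le_or_gt 0 (γ.diff δ ‖y - x‖) with hk | hk
  · rw [two, two, ← ENNReal.ofReal_add (by positivity) (by positivity)]
    refine ENNReal.ofReal_le_ofReal ?_
    simp only [Pi.add_apply]
    nlinarith [mul_nonneg hk (sq_nonneg ((u y - u x) - (v y - v x)))]
  · rw [ENNReal.ofReal_of_nonpos (mul_nonpos_of_nonpos_of_nonneg hk.le (sq_nonneg _))]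
    exact zero_le

theorem energyDensity_smul (γ : DiffusionKernel d) (δ c : ℝ) (u : Space d → ℝ) (x y : Space d) :
    energyDensity γ δ (c • u) x y = ENNReal.ofReal (c ^ 2) * energyDensity γ δ u x y := by
  unfold energyDensity
  rw [← ENNReal.ofReal_mul (sq_nonneg c)]
  congr 1
  simp only [Pi.smul_apply, smul_eq_mul]
  ring

theorem lintegral_const_mul_iterated {μ : Measure (Space d)} [SFinite μ]
    {F : Space d → Space d → ℝ≥0∞} (hF : Measurable (Function.uncurry F)) (c : ℝ≥0∞) :
    ∫⁻ x, ∫⁻ y, c * F x y ∂μ ∂μ = c * ∫⁻ x, ∫⁻ y, F x y ∂μ ∂μ := by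
  have h : ∀ x, ∫⁻ y, c * F x y ∂μ = c * ∫⁻ y, F x y ∂μ := fun x =>
    lintegral_const_mul c (hF.comp measurable_prodMk_left)
  simp_rw [h]
  exact lintegral_const_mul c hF.lintegral_prod_right'

theorem lintegral_add_iterated {μ : Measure (Space d)} [SFinite μ]
    {F : Space d → Space d → ℝ≥0∞} (hF : Measurable (Function.uncurry F))
    (G : Space d → Space d → ℝ≥0∞) :
    ∫⁻ x, ∫⁻ y, (F x y + G x y) ∂μ ∂μ = ∫⁻ x, ∫⁻ y, F x y ∂μ ∂μ + ∫⁻ x, ∫⁻ y, G x y ∂μ ∂μ := by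
  have h : ∀ x, ∫⁻ y, (F x y + G x y) ∂μ = ∫⁻ y, F x y ∂μ + ∫⁻ y, G x y ∂μ := fun x =>
    lintegral_add_left (hF.comp measurable_prodMk_left) _
  simp_rw [h]
  exact lintegral_add_left hF.lintegral_prod_right' _

/-- The double integral `∫_{Ω_δ} ∫_{Ω_δ} γ_δ^diff(|y - x|) (u(y) - u(x))² dy dx` in `[0, ∞]`. -/
def energy (γ : DiffusionKernel d) (δ : ℝ) (Ω : Set (Space d)) (u : Space d → ℝ) : ℝ≥0∞ :=
  ∫⁻ x in extendedDomain δ Ω, ∫⁻ y in extendedDomain δ Ω, energyDensity γ δ u x y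

theorem energy_congr (γ : DiffusionKernel d) (δ : ℝ) (Ω : Set (Space d)) {u v : Space d → ℝ}
    (h : u =ᵐ[volume.restrict (extendedDomain δ Ω)] v) : energy γ δ Ω u = energy γ δ Ω v := by
  refine lintegral_congr_ae ?_
  filter_upwards [h] with x hx
  refine lintegral_congr_ae ?_
  filter_upwards [h] with y hy
  rw [energyDensity, energyDensity, hx, hy]

theorem energy_add_lt_top (γ : DiffusionKernel d) {δ : ℝ} (Ω : Set (Space d))
    {u v : Space d → ℝ} (hu : Measurable u) (hv : Measurable v)
    (hue : energy γ δ Ω u < ∞) (hve : energy γ δ Ω v < ∞) : energy γ δ Ω (u + v) < ∞ := by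
  have hmu := measurable_energyDensity γ δ hu
  have hmv := measurable_energyDensity γ δ hv
  have hle : energy γ δ Ω (u + v) ≤ 2 * energy γ δ Ω u + 2 * energy γ δ Ω v := by
    unfold energy
    rw [← lintegral_const_mul_iterated hmu, ← lintegral_const_mul_iterated hmv,
      ← lintegral_add_iterated (hmu.const_mul 2)]
    exact lintegral_mono fun x => lintegral_mono fun y => energyDensity_add_le γ δ u v x y
  exact hle.trans_lt (ENNReal.add_lt_top.2
    ⟨ENNReal.mul_lt_top (by simp) hue, ENNReal.mul_lt_top (by simp) hve⟩)

theorem energy_smul_lt_top (γ : DiffusionKernel d) {δ : ℝ} (Ω : Set (Space d)) (c : ℝ)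
    {u : Space d → ℝ} (hu : Measurable u) (hue : energy γ δ Ω u < ∞) :
    energy γ δ Ω (c • u) < ∞ := by
  have hle : energy γ δ Ω (c • u) = ENNReal.ofReal (c ^ 2) * energy γ δ Ω u := by
    unfold energy
    simp_rw [energyDensity_smul]
    exact lintegral_const_mul_iterated (measurable_energyDensity γ δ hu) _
  rw [hle]
  exact ENNReal.mul_lt_top ENNReal.ofReal_lt_top hue

/-- The energy space `S_δ(Ω)`: the (classes of) functions in `L²(Ω_δ)` with finite energy that
vanish almost everywhere on the interaction domain. -/
def energySpace (γ : DiffusionKernel d) (δ : ℝ) (Ω : Set (Space d)) :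
    Submodule ℝ (Lp ℝ 2 (volume.restrict (extendedDomain δ Ω))) where
  carrier := {u | energy γ δ Ω u < ∞ ∧ ∀ᵐ x ∂volume.restrict (interactionDomain δ Ω), u x = 0}
  zero_mem' := by
    have h := Lp.coeFn_zero ℝ 2 (volume.restrict (extendedDomain δ Ω))
    refine ⟨?_, ?_⟩
    · rw [energy_congr γ δ Ω h]
      simp [energy, energyDensity]
    · exact ae_mono (Measure.restrict_mono subset_union_right le_rfl) h
  add_mem' := by
    rintro u v ⟨hu, hu0⟩ ⟨hv, hv0⟩
    have h := Lp.coeFn_add u v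
    refine ⟨?_, ?_⟩
    · rw [energy_congr γ δ Ω h]
      exact energy_add_lt_top γ Ω (Lp.stronglyMeasurable u).measurable
        (Lp.stronglyMeasurable v).measurable hu hv
    · have h' := ae_mono (Measure.restrict_mono subset_union_right le_rfl) h
      filter_upwards [h', hu0, hv0] with x hx h1 h2
      exact hx.trans (by rw [Pi.add_apply, h1, h2, add_zero])
  smul_mem' := by
    rintro c u ⟨hu, hu0⟩
    have h := Lp.coeFn_smul c u
    refine ⟨?_, ?_⟩
    · rw [energy_congr γ δ Ω h]
      exact energy_smul_lt_top γ Ω c (Lp.stronglyMeasurable u).measurable hu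
    · have h' := ae_mono (Measure.restrict_mono subset_union_right le_rfl) h
      filter_upwards [h', hu0] with x hx h1
      exact hx.trans (by rw [Pi.smul_apply, h1, smul_zero])

/-- `a(u, v) = ∫_{Ω_δ} ∫_{Ω_δ} γ_δ^diff(|y - x|) (u(y) - u(x)) (v(y) - v(x)) dy dx`. -/
def diffusionForm (γ : DiffusionKernel d) (δ : ℝ) (Ω : Set (Space d)) (u v : Space d → ℝ) : ℝ :=
  ∫ x in extendedDomain δ Ω, ∫ y in extendedDomain δ Ω,
    γ.diff δ ‖y - x‖ * (u y - u x) * (v y - v x)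

/-- The nonlocal gradient
`G_δ u(x) = ∫_{H(x)} (y - x) / |y - x| γ_δ^conv(|y - x|) (u(y) - u(x)) dy`. -/
def nonlocalGradient (γ : DiffusionKernel d) (η δ : ℝ) (H : Space d → Set (Space d))
    (u : Space d → ℝ) (x : Space d) : Space d :=
  ∫ y in H x, (γ.conv η δ ‖y - x‖ * (u y - u x)) • (‖y - x‖⁻¹ • (y - x))

/-- The nonlocal divergence of `b` at `x`, with the ball of radius `r` about `x` cut out. -/
def truncatedDivergence (γ : DiffusionKernel d) (η δ : ℝ) (H : Space d → Set (Space d))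
    (b : Space d → Space d) (r : ℝ) (x : Space d) : ℝ :=
  ∫ y in {y | r < ‖y - x‖},
    ⟪(H x).indicator (fun _ => b x) y + (H y).indicator (fun _ => b y) x,
      ‖y - x‖⁻¹ • (y - x)⟫ * γ.conv η δ ‖y - x‖

/-- The nonlocal divergence `D_δ(b)(x)` exists as a principal value and equals `L`. -/
def HasNonlocalDivergence (γ : DiffusionKernel d) (η δ : ℝ) (H : Space d → Set (Space d))
    (b : Space d → Space d) (x : Space d) (L : ℝ) : Prop :=
  Tendsto (fun r => truncatedDivergence γ η δ H b r x) (𝓝[>] 0) (𝓝 L)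

/-- First case: constant velocity, and the influence region is the full ball, so that its volume
fraction is `η = 1`. -/
structure IsCentralModel (δ : ℝ) (b : Space d → Space d) (H : Space d → Set (Space d)) (η : ℝ) :
    Prop where
  velocity : ∃ b₀ : Space d, ∀ x, b x = b₀
  region : ∀ x, H x = Metric.ball x δ
  fraction : η = 1

/-- Second case: bounded velocity with `-D_δ(b) ≥ 0` almost everywhere in `Ω`, and the influence
region is the upwind hemisphere, whose volume fraction (where `b` does not vanish) is
`η = 1 / 2`. -/
structure IsUpwindModel (γ : DiffusionKernel d) (δ : ℝ) (Ω : Set (Space d))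
    (b : Space d → Space d) (H : Space d → Set (Space d)) (η : ℝ) : Prop where
  velocity : MemLp b ∞ volume
  region : ∀ x, H x = {y | y ∈ Metric.ball x δ ∧ 0 < -⟪b x, y - x⟫}
  fraction : η = 1 / 2
  divergence : ∀ᵐ x ∂volume.restrict Ω, ∃ L : ℝ, HasNonlocalDivergence γ η δ H b x L ∧ 0 ≤ -L

/-- The bilinear form `b(u, v) = ε a(u, v) + (b · G_δ u, v)_{L²(Ω)}` of the nonlocal
convection-diffusion problem on `S_δ(Ω)`. -/
def convDiffForm (γ : DiffusionKernel d) (δ : ℝ) (Ω : Set (Space d)) (b : Space d → Space d)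
    (H : Space d → Set (Space d)) (η ε : ℝ) (u v : energySpace γ δ Ω) : ℝ :=
  ε * diffusionForm γ δ Ω u.1 v.1 + ∫ x in Ω, ⟪b x, nonlocalGradient γ η δ H u.1 x⟫ * v.1 x

/-- The energy norm `‖u‖_U = a(u, u)^{1/2}` on `S_δ(Ω)`. -/
def energyNorm (γ : DiffusionKernel d) (δ : ℝ) (Ω : Set (Space d)) (u : energySpace γ δ Ω) : ℝ :=
  Real.sqrt (diffusionForm γ δ Ω u.1 u.1)

/-- The optimal test norm of `v` is the supremum of these quotients `|b(u, v)| / ‖u‖_U` over `u`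
(the quotient at `u = 0` is `0`). -/
def optimalQuotient (γ : DiffusionKernel d) (δ : ℝ) (Ω : Set (Space d)) (b : Space d → Space d)
    (H : Space d → Set (Space d)) (η ε : ℝ) (v u : energySpace γ δ Ω) : ℝ :=
  |convDiffForm γ δ Ω b H η ε u v| / energyNorm γ δ Ω u

/-- The optimal test norm `‖v‖_{opt,V} = sup_u |b(u, v)| / ‖u‖_U`. -/
def optimalNorm (γ : DiffusionKernel d) (δ : ℝ) (Ω : Set (Space d)) (b : Space d → Space d)
    (H : Space d → Set (Space d)) (η ε : ℝ) (v : energySpace γ δ Ω) : ℝ :=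
  ⨆ u, optimalQuotient γ δ Ω b H η ε v u

/-- `N` is a norm on the real vector space `X`. -/
structure IsNorm {X : Type*} [AddCommGroup X] [Module ℝ X] (N : X → ℝ) : Prop where
  nonneg : ∀ x, 0 ≤ N x
  eq_zero_iff : ∀ x, N x = 0 ↔ x = 0
  add_le : ∀ x y, N (x + y) ≤ N x + N y
  smul : ∀ (c : ℝ) (x : X), N (c • x) = |c| * N x

/-- The linear functional `f` is continuous for the norm `N`, that is, it lies in the dual space. -/
def IsBoundedFunctional {X : Type*} [AddCommGroup X] [Module ℝ X] (N : X → ℝ) (f : X →ₗ[ℝ] ℝ) :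
    Prop :=
  ∃ C : ℝ, ∀ v, |f v| ≤ C * N v

/-- The dual norm `sup_v |f(v)| / N(v)` (the quotient at `v = 0` is `0`). -/
def dualNorm {X : Type*} [AddCommGroup X] [Module ℝ X] (N : X → ℝ) (f : X →ₗ[ℝ] ℝ) : ℝ :=
  ⨆ v, |f v| / N v

end NonlocalCD

end

/-! Let k be the diffusion kernel cut off to the open ball of radius δ, and send a function u,
extended by zero outside Ω, to its weighted increments √k(y - x) (u(y) - u(x)) in L²(ℝ^d × ℝ^d).
This map, `energyMap`, is an isometry for a. The nonlocal Poincaré inequality makes it injective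
with closed range, so U is a Hilbert space. Because γ_δ^conv(r) = η⁻¹ r γ_δ^diff(r), the convection
term has the form ∬ k(y - x) q(x, y) (u(y) - u(x)) v(x) with |q(x, y)| ≤ C |y - x|. Integrability of
k(z)|z|² and Poincaré then make b bounded on U × U (`exists_driftForm_bound`).

For a bounded form that is uniquely solvable, write b(u, v) = ⟪u, A v⟫. The operator A is bijective,
the optimal test norm is ‖A v‖, and the dual norm of f = b(u, ·) is the supremum of |⟪u, A v⟫| / ‖A
v‖, which equals ‖u‖ since A v takes every value (`wellPosed_optimalNorm`). So everything reduces to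
unique solvability.

In the central model q is an odd function of y - x. Exchanging x and y and using translation
invariance shows that the convection term vanishes on the diagonal, so b(u, u) = ε a(u, u) and
Lax–Milgram applies.

In the upwind model q ≤ 0. Convection over distances below a small r is absorbed by ε a. Over larger
distances the kernel κ = k q is bounded and non-positive; since κ (u(y) - u(x)) u(x) ≥ κ u(x) u(y),
what remains is a Hilbert–Schmidt form on the bounded set Ω, which is of finite rank up to a small
error. Hence b is coercive modulo finite rank, and by the Fredholm alternative uniqueness suffices.
Uniqueness is a weak maximum principle: a homogeneous solution that is positive somewhere is tested
with its excess w = (u - c)⁺ over a level c just below its essential supremum. The far part of the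
convection can be negative only where c < u(x) < u(y), so only for x in a set of small measure. It
is then also absorbed by ε a, forcing w = 0, which contradicts the choice of c. -/

namespace NonlocalCD

/-! ### Bounded, uniquely solvable forms on a Hilbert space -/

section Abstract

variable {X : Type*} [AddCommGroup X] [Module ℝ X]
variable {E : Type*} [NormedAddCommGroup E] [InnerProductSpace ℝ E]

/-- A bilinear form that is bounded for the norm pulled back from a Hilbert space by a linear
equivalence is represented by a bounded operator. -/
theorem exists_operator_of_bounded (e : X ≃ₗ[ℝ] E) (B : X →ₗ[ℝ] X →ₗ[ℝ] ℝ) {C : ℝ}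
    (hB : ∀ u v, |B u v| ≤ C * ‖e u‖ * ‖e v‖) :
    ∃ b : E →L[ℝ] E →L[ℝ] ℝ, ∀ u v, b (e u) (e v) = B u v := by
  refine ⟨LinearMap.mkContinuous₂ (B.compl₁₂ e.symm.toLinearMap e.symm.toLinearMap) C
    (fun x y => ?_), fun u v => ?_⟩
  · simpa using hB (e.symm x) (e.symm y)
  · simp

theorem exists_riesz_of_bounded [CompleteSpace E] (e : X ≃ₗ[ℝ] E) (g : X →ₗ[ℝ] ℝ) {C : ℝ}
    (hg : ∀ v, |g v| ≤ C * ‖e v‖) : ∃ w : E, ∀ v, g v = ⟪w, e v⟫ := by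
  let g' : E →L[ℝ] ℝ := LinearMap.mkContinuous (g ∘ₗ e.symm.toLinearMap) C
    (fun x => by simpa using hg (e.symm x))
  refine ⟨(InnerProductSpace.toDual ℝ E).symm g', fun v => ?_⟩
  rw [InnerProductSpace.toDual_symm_apply]
  simp [g']

/-- The Lax–Milgram theorem for forms on a space carrying a pulled back Hilbert norm. -/
theorem exists_solution_of_coercive [CompleteSpace E] (e : X ≃ₗ[ℝ] E) (A : X →ₗ[ℝ] X →ₗ[ℝ] ℝ) {C c : ℝ}
    (hA : ∀ u v, |A u v| ≤ C * ‖e u‖ * ‖e v‖) (hc : 0 < c)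
    (hcoer : ∀ u, c * ‖e u‖ ^ 2 ≤ A u u) (g : X →ₗ[ℝ] ℝ) {D : ℝ}
    (hg : ∀ v, |g v| ≤ D * ‖e v‖) : ∃ u, ∀ v, A u v = g v := by
  obtain ⟨a, ha⟩ := exists_operator_of_bounded e A hA
  have hcoer' : IsCoercive a := by
    refine ⟨c, hc, fun x => ?_⟩
    have h := hcoer (e.symm x)
    rw [← ha, e.apply_symm_apply] at h
    nlinarith
  obtain ⟨w, hw⟩ := exists_riesz_of_bounded e g hg
  refine ⟨e.symm (hcoer'.continuousLinearEquivOfBilin.symm w), fun v => ?_⟩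
  rw [← ha, e.apply_symm_apply, ← hcoer'.continuousLinearEquivOfBilin_apply,
    ContinuousLinearEquiv.apply_symm_apply, hw]

/-- A finite rank perturbation of a solvable problem is solvable as soon as it has at most one
solution. -/
theorem exists_solution_of_finiteRank (e : X ≃ₗ[ℝ] E) (A B : X →ₗ[ℝ] X →ₗ[ℝ] ℝ) {n : ℕ}
    (φ ψ : Fin n → X →ₗ[ℝ] ℝ)
    (hA : ∀ (g : X →ₗ[ℝ] ℝ) (D : ℝ), (∀ v, |g v| ≤ D * ‖e v‖) → ∃ u, ∀ v, A u v = g v)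
    (hψ : ∀ i, ∃ D, ∀ v, |ψ i v| ≤ D * ‖e v‖)
    (hB : ∀ u v, B u v = A u v + ∑ i, φ i u * ψ i v)
    (hinj : ∀ u, (∀ v, B u v = 0) → u = 0) (g : X →ₗ[ℝ] ℝ) {D : ℝ}
    (hg : ∀ v, |g v| ≤ D * ‖e v‖) : ∃ u, ∀ v, B u v = g v := by
  choose Dψ hDψ using hψ
  choose a ha using fun i => hA (ψ i) (Dψ i) (hDψ i)
  obtain ⟨u₀, hu₀⟩ := hA g D hg
  -- With `a i` solving `A (a i) = ψ i`, the ansatz u = u₀ - ∑ cᵢ aᵢ solves the perturbed problem as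
  -- soon as cᵢ = φᵢ(u), that is, (1 + Φ S) c = Φ u₀. A kernel vector c of this finite system makes
  -- S c a homogeneous solution, so injectivity of B gives invertibility of the system.
  let S : (Fin n → ℝ) →ₗ[ℝ] X := Fintype.linearCombination ℝ a
  let Φ : X →ₗ[ℝ] (Fin n → ℝ) := LinearMap.pi φ
  let M : (Fin n → ℝ) →ₗ[ℝ] (Fin n → ℝ) := LinearMap.id + Φ ∘ₗ S
  have hAS : ∀ c v, A (S c) v = ∑ i, c i * ψ i v := fun c v => by
    simp [S, Fintype.linearCombination_apply, ha]
  have hMinj : Function.Injective M := by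
    refine (injective_iff_map_eq_zero M).2 fun c hc => ?_
    have hc' : ∀ i, c i = -φ i (S c) := fun i => by
      have := congrFun hc i
      simp only [M, Φ, LinearMap.add_apply, LinearMap.id_apply, LinearMap.comp_apply, Pi.add_apply,
        LinearMap.pi_apply, Pi.zero_apply] at this
      linarith
    have h0 : S c = 0 := hinj _ fun v => by
      rw [hB, hAS, ← Finset.sum_add_distrib]
      refine Finset.sum_eq_zero fun i _ => ?_
      rw [← add_mul, hc' i, neg_add_cancel, zero_mul]
    funext i
    rw [hc' i, h0, map_zero, neg_zero, Pi.zero_apply]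
  obtain ⟨c, hc⟩ := (LinearMap.injective_iff_surjective.1 hMinj) (Φ u₀)
  refine ⟨u₀ - S c, fun v => ?_⟩
  have hc' : ∀ i, c i = φ i (u₀ - S c) := fun i => by
    have := congrFun hc i
    simp only [M, Φ, LinearMap.add_apply, LinearMap.id_apply, LinearMap.comp_apply, Pi.add_apply,
      LinearMap.pi_apply] at this
    rw [map_sub]
    linarith
  rw [hB, map_sub, LinearMap.sub_apply, hu₀, hAS]
  simp_rw [← hc']
  ring

/-- Well-posedness with the optimal test norm for a bounded bilinear form that is uniquely
solvable. -/
theorem wellPosed_optimalNorm [CompleteSpace E] (e : X ≃ₗ[ℝ] E) (B : X →ₗ[ℝ] X →ₗ[ℝ] ℝ) {C : ℝ}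
    (hB : ∀ u v, |B u v| ≤ C * ‖e u‖ * ‖e v‖)
    (hsol : ∀ (g : X →ₗ[ℝ] ℝ) (D : ℝ), (∀ v, |g v| ≤ D * ‖e v‖) → ∃ u, ∀ v, B u v = g v)
    (hinj : ∀ u, (∀ v, B u v = 0) → u = 0) :
    IsNorm (fun u => ‖e u‖) ∧
    (∀ v, BddAbove (range fun u => |B u v| / ‖e u‖)) ∧
    IsNorm (fun v => ⨆ u, |B u v| / ‖e u‖) ∧
    ∀ f : X →ₗ[ℝ] ℝ, IsBoundedFunctional (fun v => ⨆ u, |B u v| / ‖e u‖) f →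
      ∃ u, (∀ v, B u v = f v) ∧ (∀ w, (∀ v, B w v = f v) → w = u) ∧
        ‖e u‖ = dualNorm (fun v => ⨆ u, |B u v| / ‖e u‖) f := by
  obtain ⟨b, hb⟩ := exists_operator_of_bounded e B hB
  have hbT : ∀ u v, B u v = ⟪InnerProductSpace.continuousLinearMapOfBilin (𝕜 := ℝ) b (e u), e v⟫ :=
    fun u v => by
      rw [← hb]
      exact (InnerProductSpace.continuousLinearMapOfBilin_apply (𝕜 := ℝ) b _ _).symm
  generalize InnerProductSpace.continuousLinearMapOfBilin (𝕜 := ℝ) b = T at hbT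
  have hTinj : Function.Injective T := by
    refine (injective_iff_map_eq_zero T).2 fun x hx => ?_
    have : e.symm x = 0 := hinj _ fun v => by
      rw [hbT, e.apply_symm_apply, hx, inner_zero_left]
    simpa using this
  have hTsurj : Function.Surjective T := fun y => by
    obtain ⟨u, hu⟩ := hsol ((innerₗ E y) ∘ₗ e.toLinearMap) ‖y‖
      fun v => abs_real_inner_le_norm y (e v)
    refine ⟨e u, ext_inner_right ℝ fun x => ?_⟩
    have := hu (e.symm x)
    rw [hbT] at this
    simpa using this
  -- The open mapping theorem gives a bounded inverse; its adjoint is what inverts the adjoint of T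
  -- below.
  let T' : E ≃L[ℝ] E := ContinuousLinearEquiv.ofBijective T
    (LinearMap.ker_eq_bot.2 hTinj) (LinearMap.range_eq_top.2 hTsurj)
  have hT' : ∀ x, T' x = T x := fun x => rfl
  let A : E →L[ℝ] E := ContinuousLinearMap.adjoint T
  have hA : ∀ u v, B u v = ⟪e u, A (e v)⟫ := fun u v => by
    rw [hbT, ContinuousLinearMap.adjoint_inner_right]
  have hAinj : ∀ x, A x = 0 → x = 0 := fun x hx => by
    obtain ⟨y, hy⟩ := hTsurj x
    have : ⟪T y, x⟫ = 0 := by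
      rw [← ContinuousLinearMap.adjoint_inner_right]
      change ⟪y, A x⟫ = 0
      rw [hx, inner_zero_right]
    rw [hy] at this
    exact inner_self_eq_zero.1 this
  have hAsurj : Function.Surjective A := fun y => by
    refine ⟨ContinuousLinearMap.adjoint (T'.symm : E →L[ℝ] E) y, ext_inner_left ℝ fun x => ?_⟩
    rw [ContinuousLinearMap.adjoint_inner_right, ContinuousLinearMap.adjoint_inner_right]
    congr 1
    change T'.symm (T x) = x
    rw [← hT', T'.symm_apply_apply]
  have hq : ∀ v u, |B u v| / ‖e u‖ ≤ ‖A (e v)‖ := fun v u => by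
    rw [hA]
    refine div_le_of_le_mul₀ (norm_nonneg _) (norm_nonneg _) ?_
    rw [mul_comm]
    exact abs_real_inner_le_norm _ _
  have hbdd : ∀ v, BddAbove (range fun u => |B u v| / ‖e u‖) := fun v =>
    ⟨‖A (e v)‖, by rintro _ ⟨u, rfl⟩; exact hq v u⟩
  have hself : ∀ x : E, |⟪x, x⟫| / ‖x‖ = ‖x‖ := fun x => by
    rw [real_inner_self_eq_norm_sq, abs_of_nonneg (sq_nonneg _), pow_two, mul_self_div_self]
  -- Cauchy–Schwarz bounds the quotients, and u with e u = A (e v) attains the bound.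
  have hopt : (fun v => ⨆ u, |B u v| / ‖e u‖) = fun v => ‖A (e v)‖ := by
    funext v
    refine le_antisymm (ciSup_le (hq v)) ?_
    refine le_ciSup_of_le (hbdd v) (e.symm (A (e v))) ?_
    rw [hA, e.apply_symm_apply, hself]
  refine ⟨⟨fun _ => norm_nonneg _, fun x => by simp, fun x y => ?_, fun c x => ?_⟩, hbdd, ?_, ?_⟩
  · simpa using norm_add_le (e x) (e y)
  · simp [norm_smul]
  · rw [hopt]
    refine ⟨fun _ => norm_nonneg _, fun x => ⟨fun h => ?_, fun h => by simp [h]⟩, fun x y => ?_,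
      fun c x => ?_⟩
    · simpa using hAinj _ (norm_eq_zero.1 h)
    · simpa using norm_add_le (A (e x)) (A (e y))
    · simp [norm_smul]
  · rw [hopt]
    rintro f ⟨D, hD⟩
    obtain ⟨u, hu⟩ := hsol f (|D| * ‖A‖) fun v => by
      refine (hD v).trans ((mul_le_mul_of_nonneg_right (le_abs_self D) (norm_nonneg _)).trans ?_)
      rw [mul_assoc]
      exact mul_le_mul_of_nonneg_left (A.le_opNorm _) (abs_nonneg D)
    refine ⟨u, hu, fun w hw => ?_, ?_⟩
    · refine sub_eq_zero.1 (hinj _ fun v => ?_)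
      rw [map_sub, LinearMap.sub_apply, hw, hu, sub_self]
    · have hle : ∀ v, |f v| / ‖A (e v)‖ ≤ ‖e u‖ := fun v => by
        rw [← hu, hA]
        exact div_le_of_le_mul₀ (norm_nonneg _) (norm_nonneg _) (abs_real_inner_le_norm _ _)
      refine le_antisymm ?_ (ciSup_le hle)
      -- The dual supremum is attained at the v with A (e v) = e u.
      obtain ⟨y, hy⟩ := hAsurj (e u)
      refine le_ciSup_of_le (f := fun v => |f v| / ‖A (e v)‖)
        ⟨‖e u‖, by rintro _ ⟨v, rfl⟩; exact hle v⟩ (e.symm y) ?_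
      rw [← hu, hA, e.apply_symm_apply, hy, hself]

/-- The problem `B u = g` has exactly one solution for every functional `g` bounded by `N`. -/
structure IsUniquelySolvable (N : X → ℝ) (B : X →ₗ[ℝ] X →ₗ[ℝ] ℝ) : Prop where
  exists_solution : ∀ (g : X →ₗ[ℝ] ℝ) (D : ℝ), (∀ v, |g v| ≤ D * N v) → ∃ u, ∀ v, B u v = g v
  eq_zero : ∀ u, (∀ v, B u v = 0) → u = 0

/-- A closed range is complete, so X can be identified with a Hilbert space through J and
Lax–Milgram applies. This avoids putting a norm structure on X itself. -/
theorem isUniquelySolvable_of_coercive [CompleteSpace E] (J : X →ₗ[ℝ] E)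
    (hJ : Function.Injective J) (hJc : IsClosed (LinearMap.range J : Set E))
    (A : X →ₗ[ℝ] X →ₗ[ℝ] ℝ) {C c : ℝ} (hA : ∀ u v, |A u v| ≤ C * ‖J u‖ * ‖J v‖) (hc : 0 < c)
    (hcoer : ∀ u, c * ‖J u‖ ^ 2 ≤ A u u) : IsUniquelySolvable (fun u => ‖J u‖) A := by
  have := hJc.completeSpace_coe
  refine ⟨fun g D hg => exists_solution_of_coercive (LinearEquiv.ofInjective J hJ) A hA hc hcoer g hg,
    fun u hu => ?_⟩
  have h := hcoer u
  rw [hu] at h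
  have h0 : ‖J u‖ ^ 2 ≤ 0 := by
    by_contra hcon
    exact absurd h (not_le.2 (mul_pos hc (not_le.1 hcon)))
  have h1 : J u = 0 := norm_eq_zero.1 (sq_eq_zero_iff.1 (le_antisymm h0 (sq_nonneg _)))
  exact hJ (h1.trans (map_zero J).symm)

/-- The Fredholm alternative for a form that is coercive up to a form of finite rank. -/
theorem isUniquelySolvable_of_finiteRank [CompleteSpace E] (J : X →ₗ[ℝ] E)
    (hJ : Function.Injective J) (hJc : IsClosed (LinearMap.range J : Set E))
    (B : X →ₗ[ℝ] X →ₗ[ℝ] ℝ) {C c : ℝ} (hB : ∀ u v, |B u v| ≤ C * ‖J u‖ * ‖J v‖) {n : ℕ}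
    (φ ψ : Fin n → X →ₗ[ℝ] ℝ) (hφ : ∀ i, ∃ D, ∀ u, |φ i u| ≤ D * ‖J u‖)
    (hψ : ∀ i, ∃ D, ∀ u, |ψ i u| ≤ D * ‖J u‖) (hc : 0 < c)
    (hcoer : ∀ u, c * ‖J u‖ ^ 2 ≤ B u u - ∑ i, φ i u * ψ i u)
    (hinj : ∀ u, (∀ v, B u v = 0) → u = 0) : IsUniquelySolvable (fun u => ‖J u‖) B := by
  have := hJc.completeSpace_coe
  choose Dφ hDφ using hφ
  choose Dψ hDψ using id hψ
  let A : X →ₗ[ℝ] X →ₗ[ℝ] ℝ := B - ∑ i, (φ i).smulRight (ψ i)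
  have hA : ∀ u v, A u v = B u v - ∑ i, φ i u * ψ i v := fun u v => by
    simp [A, LinearMap.sum_apply]
  have hAb : ∀ u v, |A u v| ≤ (C + ∑ i, Dφ i * Dψ i) * ‖J u‖ * ‖J v‖ := fun u v => by
    rw [hA, add_mul, add_mul, Finset.sum_mul, Finset.sum_mul]
    refine (abs_sub _ _).trans (add_le_add (hB u v) ((Finset.abs_sum_le_sum_abs _ _).trans
      (Finset.sum_le_sum fun i _ => ?_)))
    rw [abs_mul]
    refine (mul_le_mul (hDφ i u) (hDψ i v) (abs_nonneg _)
      ((abs_nonneg _).trans (hDφ i u))).trans_eq ?_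
    ring
  have hAsol := isUniquelySolvable_of_coercive J hJ hJc A hAb hc fun u => (hA u u).symm ▸ hcoer u
  exact ⟨fun g D hg => exists_solution_of_finiteRank (LinearEquiv.ofInjective J hJ) A B φ ψ
    hAsol.exists_solution hψ (fun u v => by rw [hA, sub_add_cancel]) hinj g hg, hinj⟩

theorem wellPosed_of_isUniquelySolvable [CompleteSpace E] (J : X →ₗ[ℝ] E)
    (hJ : Function.Injective J) (hJc : IsClosed (LinearMap.range J : Set E))
    (B : X →ₗ[ℝ] X →ₗ[ℝ] ℝ) {C : ℝ} (hB : ∀ u v, |B u v| ≤ C * ‖J u‖ * ‖J v‖)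
    (hsol : IsUniquelySolvable (fun u => ‖J u‖) B) {N : X → ℝ} (hN : ∀ u, N u = ‖J u‖)
    {b : X → X → ℝ} (hb : ∀ u v, b u v = B u v) :
    IsNorm N ∧ (∀ v, BddAbove (range fun u => |b u v| / N u)) ∧
    IsNorm (fun v => ⨆ u, |b u v| / N u) ∧
    ∀ f : X →ₗ[ℝ] ℝ, IsBoundedFunctional (fun v => ⨆ u, |b u v| / N u) f →
      ∃ u, (∀ v, b u v = f v) ∧ (∀ w, (∀ v, b w v = f v) → w = u) ∧
        N u = dualNorm (fun v => ⨆ u, |b u v| / N u) f := by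
  have := hJc.completeSpace_coe
  obtain rfl : N = fun u => ‖J u‖ := funext hN
  obtain rfl : b = fun u v => B u v := funext₂ hb
  exact wellPosed_optimalNorm (LinearEquiv.ofInjective J hJ) B hB hsol.exists_solution hsol.eq_zero

end Abstract

/-! ### Square integrable kernels on products -/

section Tensor

variable {α β : Type*} [MeasurableSpace α] [MeasurableSpace β] {μ : Measure α} {ν : Measure β}

theorem memLp_tensor [SFinite μ] [SFinite ν] {f : α → ℝ} {g : β → ℝ} (hf : MemLp f 2 μ)
    (hg : MemLp g 2 ν) :
    MemLp (fun p : α × β => f p.1 * g p.2) 2 (μ.prod ν) := by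
  have hm : AEStronglyMeasurable (fun p : α × β => f p.1 * g p.2) (μ.prod ν) :=
    hf.1.comp_fst.mul hg.1.comp_snd
  refine (memLp_two_iff_integrable_sq hm).2 ?_
  have := ((memLp_two_iff_integrable_sq hf.1).1 hf).mul_prod
    ((memLp_two_iff_integrable_sq hg.1).1 hg)
  refine this.congr (ae_of_all _ fun p => ?_)
  simp only [mul_pow]

theorem integral_tensor_sq [SFinite μ] [SFinite ν] (f : α → ℝ) (g : β → ℝ) :
    ∫ p, (f p.1 * g p.2) ^ 2 ∂μ.prod ν = (∫ x, f x ^ 2 ∂μ) * ∫ y, g y ^ 2 ∂ν := by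
  simp_rw [mul_pow]
  exact integral_prod_mul (fun x => f x ^ 2) fun y => g y ^ 2

/-- A square integrable kernel on a finite product that integrates to zero over all rectangles
vanishes. -/
theorem ae_eq_zero_of_forall_rectangle [IsFiniteMeasure μ] [IsFiniteMeasure ν] {h : α × β → ℝ}
    (hh : Integrable h (μ.prod ν))
    (h0 : ∀ s t, MeasurableSet s → MeasurableSet t → ∫ p in s ×ˢ t, h p ∂μ.prod ν = 0) :
    h =ᵐ[μ.prod ν] 0 := by
  have huniv : ∫ p, h p ∂μ.prod ν = 0 := by
    simpa using h0 univ univ MeasurableSet.univ MeasurableSet.univ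
  refine hh.ae_eq_zero_of_forall_setIntegral_eq_zero fun s hs hfin => ?_
  clear hfin
  -- Rectangles form a π-system generating the product σ-algebra. The vanishing of the total
  -- integral handles complements.
  induction s, hs using MeasurableSpace.induction_on_inter generateFrom_prod.symm isPiSystem_prod with
  | empty => simp
  | basic t ht =>
    obtain ⟨a, ha, b, hb, rfl⟩ := ht
    exact h0 a b ha hb
  | compl t ht ih =>
    have := integral_add_compl ht hh
    rw [ih, huniv, zero_add] at this
    exact this
  | iUnion f hd hm ih =>
    rw [integral_iUnion hm hd hh.integrableOn]
    simp [ih]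

/-- Finite sums of tensors are dense among the square integrable kernels. -/
theorem exists_sum_tensor_close [IsFiniteMeasure μ] [IsFiniteMeasure ν] {h : α × β → ℝ}
    (hh : MemLp h 2 (μ.prod ν)) {θ : ℝ} (hθ : 0 < θ) :
    ∃ (n : ℕ) (a : Fin n → α → ℝ) (b : Fin n → β → ℝ),
      (∀ i, MemLp (a i) 2 μ) ∧ (∀ i, MemLp (b i) 2 ν) ∧
      ∫ p, (h p - ∑ i, a i p.1 * b i p.2) ^ 2 ∂μ.prod ν ≤ θ ^ 2 := by
  let P : Set (Lp ℝ 2 (μ.prod ν)) := {F | ∃ (a : α → ℝ) (b : β → ℝ), MemLp a 2 μ ∧ MemLp b 2 ν ∧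
    F =ᵐ[μ.prod ν] fun p => a p.1 * b p.2}
  -- A function orthogonal to all tensors is in particular orthogonal to indicators of rectangles,
  -- hence zero.
  have hdense : (Submodule.span ℝ P).topologicalClosure = ⊤ := by
    rw [Submodule.topologicalClosure_eq_top_iff, Submodule.eq_bot_iff]
    intro F hF
    rw [Submodule.mem_orthogonal] at hF
    refine Lp.ext ?_
    refine (ae_eq_zero_of_forall_rectangle ((Lp.memLp F).integrable one_le_two) ?_).trans
      (Lp.coeFn_zero ℝ 2 _).symm
    intro s t hs ht
    have hst : MeasurableSet (s ×ˢ t) := hs.prod ht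
    have hmem : indicatorConstLp 2 hst (measure_ne_top (μ.prod ν) _) (1 : ℝ) ∈ P := by
      refine ⟨s.indicator fun _ => 1, t.indicator fun _ => 1, memLp_indicator_const 2 hs 1 (by simp),
        memLp_indicator_const 2 ht 1 (by simp), indicatorConstLp_coeFn.trans (ae_of_all _ ?_)⟩
      rintro ⟨x, y⟩
      by_cases hx : x ∈ s <;> by_cases hy : y ∈ t <;> simp [hx, hy]
    have := hF _ (Submodule.subset_span hmem)
    rwa [L2.inner_indicatorConstLp_one] at this
  have hmem : hh.toLp h ∈ closure (Submodule.span ℝ P : Set (Lp ℝ 2 (μ.prod ν))) := by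
    rw [← Submodule.topologicalClosure_coe, hdense]
    trivial
  obtain ⟨F, hF, hdist⟩ := Metric.mem_closure_iff.1 hmem θ hθ
  obtain ⟨n, c, G, rfl⟩ := Submodule.mem_span_set'.1 hF
  choose a b ha hb hab using fun i => (G i).2
  refine ⟨n, fun i x => c i * a i x, b, fun i => (ha i).const_mul _, hb, ?_⟩
  have hsum : ((∑ i, c i • (G i : Lp ℝ 2 (μ.prod ν)) : Lp ℝ 2 (μ.prod ν)) : α × β → ℝ)
      =ᵐ[μ.prod ν] fun p => ∑ i, c i * a i p.1 * b i p.2 := by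
    have h1 := Lp.coeFn_finsetSum (p := 2) (μ := μ.prod ν) Finset.univ
      (fun i => c i • (G i : Lp ℝ 2 (μ.prod ν)))
    have h2 : ∀ i, ((c i • (G i : Lp ℝ 2 (μ.prod ν)) : Lp ℝ 2 (μ.prod ν)) : α × β → ℝ)
        =ᵐ[μ.prod ν] fun p => c i * a i p.1 * b i p.2 := fun i => by
      filter_upwards [Lp.coeFn_smul (c i) (G i : Lp ℝ 2 (μ.prod ν)), hab i] with p h3 h4
      rw [h3, Pi.smul_apply, h4, smul_eq_mul, mul_assoc]
    filter_upwards [h1, ae_all_iff.2 h2] with p h3 h4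
    rw [h3, Finset.sum_apply]
    exact Finset.sum_congr rfl fun i _ => h4 i
  have hn : ‖hh.toLp h - ∑ i, c i • (G i : Lp ℝ 2 (μ.prod ν))‖ ^ 2 ≤ θ ^ 2 := by
    rw [dist_eq_norm] at hdist
    exact pow_le_pow_left₀ (norm_nonneg _) hdist.le 2
  refine le_of_eq_of_le ?_ hn
  rw [← real_inner_self_eq_norm_sq, L2.inner_def]
  refine integral_congr_ae ?_
  filter_upwards [hsum, hh.coeFn_toLp, Lp.coeFn_sub (hh.toLp h)
    (∑ i, c i • (G i : Lp ℝ 2 (μ.prod ν)))] with p h1 h2 h3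
  rw [h3, Pi.sub_apply, h1, h2]
  simp [pow_two]

theorem abs_integral_mul_le {f g : α → ℝ} (hf : MemLp f 2 μ) (hg : MemLp g 2 μ) :
    |∫ x, f x * g x ∂μ| ≤ √(∫ x, f x ^ 2 ∂μ) * √(∫ x, g x ^ 2 ∂μ) := by
  have key : ∀ {f g : α → ℝ} (hf : MemLp f 2 μ) (hg : MemLp g 2 μ),
      ⟪hf.toLp f, hg.toLp g⟫ = ∫ x, f x * g x ∂μ := fun {f g} hf hg => by
    rw [L2.inner_def]
    refine integral_congr_ae ?_
    filter_upwards [hf.coeFn_toLp, hg.coeFn_toLp] with x h1 h2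
    rw [h1, h2]
    simp [mul_comm]
  have hn : ∀ {f : α → ℝ} (hf : MemLp f 2 μ), ‖hf.toLp f‖ = √(∫ x, f x ^ 2 ∂μ) := fun {f} hf => by
    rw [norm_eq_sqrt_real_inner, key]
    simp_rw [pow_two]
  rw [← key hf hg, ← hn hf, ← hn hg]
  exact abs_real_inner_le_norm _ _

end Tensor

/-! ### The cut kernel and the geometry of the extended domain -/

variable {d : ℕ}

/-- The properties of a radially decreasing kernel with finite second moment that are used below. -/
structure IsSingularKernel (k : Space d → ℝ) : Prop where
  measurable : Measurable k
  nonneg : ∀ z, 0 ≤ k z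
  even : ∀ z, k (-z) = k z
  moment : Integrable (fun z => k z * ‖z‖ ^ 2)
  lower : ∃ ρ > 0, ∃ c > 0, ∀ z, 0 < ‖z‖ → ‖z‖ < ρ → c ≤ k z
  bounded_away : ∀ r > 0, ∃ C, ∀ z, r ≤ ‖z‖ → k z * ‖z‖ ≤ C

/-- The diffusion kernel as a function on the space, cut off outside the open ball. -/
noncomputable def cutKernel (γ : DiffusionKernel d) (δ : ℝ) : Space d → ℝ :=
  (Metric.ball 0 δ).indicator fun z => γ.diff δ ‖z‖

theorem DiffusionKernel.profile_nonneg (γ : DiffusionKernel d) (r : ℝ) : 0 ≤ γ.profile r :=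
  indicator_nonneg γ.nonneg r

theorem DiffusionKernel.diff_nonneg (γ : DiffusionKernel d) {δ : ℝ} (hδ : 0 < δ) (r : ℝ) :
    0 ≤ γ.diff δ r :=
  mul_nonneg (by positivity) (γ.profile_nonneg _)

theorem DiffusionKernel.diff_eq_zero (γ : DiffusionKernel d) {δ r : ℝ} (hδ : 0 < δ) (hr : δ < r) :
    γ.diff δ r = 0 := by
  have : r / δ ∉ Ioc (0 : ℝ) 1 := fun h => by
    have := h.2
    rw [div_le_one hδ] at this
    linarith
  rw [diff, profile, indicator_of_notMem this, mul_zero]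

/-- The profile may be nonzero at radius exactly δ, where the cut kernel is zero. The sphere is
null, so integrals do not see the difference. -/
theorem cutKernel_eq (γ : DiffusionKernel d) {δ : ℝ} (hδ : 0 < δ) {z : Space d} (hz : ‖z‖ ≠ δ) :
    cutKernel γ δ z = γ.diff δ ‖z‖ := by
  by_cases h : ‖z‖ < δ
  · rw [cutKernel, indicator_of_mem (by simpa using h)]
  · rw [cutKernel, indicator_of_notMem (by simpa using h),
      γ.diff_eq_zero hδ (lt_of_le_of_ne (not_lt.1 h) hz.symm)]

theorem cutKernel_eq_zero (γ : DiffusionKernel d) {δ : ℝ} {z : Space d} (hz : δ ≤ ‖z‖) :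
    cutKernel γ δ z = 0 := by
  rw [cutKernel, indicator_of_notMem (by simpa using hz)]

/-- Integrability is hidden in the normalization: the integral of a non-integrable function is 0 by
convention, whereas the moment equals d > 0. -/
theorem integrable_profile_mul_sq (hd : 0 < d) (γ : DiffusionKernel d) :
    Integrable ((Metric.ball (0 : Space d) 1).indicator fun s => γ.profile ‖s‖ * ‖s‖ ^ 2) := by
  have h : IntegrableOn (fun s : Space d => γ.toFun ‖s‖ * ‖s‖ ^ 2) (Metric.ball 0 1) := by
    by_contra h
    have := γ.moment
    rw [integral_undef h] at this
    exact hd.ne (by exact_mod_cast this)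
  rw [integrable_indicator_iff Metric.isOpen_ball.measurableSet]
  refine h.congr_fun (fun s hs => ?_) Metric.isOpen_ball.measurableSet
  rcases eq_or_ne s 0 with rfl | h0
  · simp
  · have : ‖s‖ ∈ Ioc (0 : ℝ) 1 := ⟨norm_pos_iff.2 h0, (by simpa using hs : ‖s‖ < 1).le⟩
    simp only [DiffusionKernel.profile, indicator_of_mem this]

theorem exists_toFun_pos (hd : 0 < d) (γ : DiffusionKernel d) : ∃ r ∈ Ioo (0 : ℝ) 1, 0 < γ.toFun r := by
  by_contra! h
  have := γ.moment
  rw [setIntegral_eq_zero_of_forall_eq_zero] at this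
  · exact hd.ne (by exact_mod_cast this)
  · intro s hs
    rcases eq_or_ne s 0 with rfl | h0
    · simp
    · have h1 : ‖s‖ ∈ Ioo (0 : ℝ) 1 := ⟨norm_pos_iff.2 h0, by simpa using hs⟩
      rw [le_antisymm (h _ h1) (γ.nonneg _ ⟨h1.1, h1.2.le⟩), zero_mul]

theorem isSingularKernel_cutKernel (hd : 0 < d) (γ : DiffusionKernel d) {δ : ℝ} (hδ : 0 < δ) :
    IsSingularKernel (cutKernel γ δ) where
  measurable := ((γ.measurable_diff δ).comp measurable_norm).indicator
    Metric.isOpen_ball.measurableSet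
  nonneg z := indicator_nonneg (fun z _ => γ.diff_nonneg hδ _) z
  even z := by
    by_cases h : ‖z‖ < δ <;> simp [cutKernel, h]
  moment := by
    have h := ((integrable_profile_mul_sq hd γ).comp_smul (inv_ne_zero hδ.ne')).const_mul
      (1 / δ ^ (d + 2) * δ ^ 2)
    refine h.congr (ae_of_all _ fun z => ?_)
    have hz : ‖δ⁻¹ • z‖ = ‖z‖ / δ := by
      rw [norm_smul, norm_inv, Real.norm_of_nonneg hδ.le, inv_mul_eq_div]
    by_cases h : ‖z‖ < δ
    · have h' : δ⁻¹ • z ∈ Metric.ball (0 : Space d) 1 := by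
        rw [mem_ball_zero_iff, hz, div_lt_one hδ]
        exact h
      simp only [indicator_of_mem h', hz, cutKernel,
        indicator_of_mem (show z ∈ Metric.ball (0 : Space d) δ by simpa using h),
        DiffusionKernel.diff]
      field_simp
    · have h' : δ⁻¹ • z ∉ Metric.ball (0 : Space d) 1 := by
        rw [mem_ball_zero_iff, hz, div_lt_one hδ]
        exact h
      simp only [indicator_of_notMem h', cutKernel_eq_zero γ (not_lt.1 h), mul_zero, zero_mul]
  lower := by
    -- Monotonicity propagates one positive value of the profile to all smaller radii.
    obtain ⟨r, ⟨hr0, hr1⟩, hr⟩ := exists_toFun_pos hd γ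
    refine ⟨r * δ, mul_pos hr0 hδ, 1 / δ ^ (d + 2) * γ.toFun r, by positivity, fun z hz hzr => ?_⟩
    have hzδ : ‖z‖ < δ := hzr.trans (mul_lt_of_lt_one_left hδ hr1)
    have h1 : ‖z‖ / δ ∈ Ioc (0 : ℝ) 1 := ⟨by positivity, (div_le_one hδ).2 hzδ.le⟩
    rw [cutKernel_eq γ hδ hzδ.ne, DiffusionKernel.diff, DiffusionKernel.profile,
      indicator_of_mem h1]
    exact mul_le_mul_of_nonneg_left (γ.antitone h1 ⟨hr0, hr1.le⟩ ((div_le_iff₀ hδ).2 hzr.le))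
      (by positivity)
  bounded_away r hr := by
    refine ⟨1 / δ ^ (d + 2) * |γ.toFun (r / δ)| * δ, fun z hz => ?_⟩
    by_cases h : ‖z‖ < δ
    · have h1 : ‖z‖ / δ ∈ Ioc (0 : ℝ) 1 := ⟨div_pos (hr.trans_le hz) hδ, (div_le_one hδ).2 h.le⟩
      have h2 : r / δ ∈ Ioc (0 : ℝ) 1 := ⟨div_pos hr hδ, (div_le_one hδ).2 (hz.trans h.le)⟩
      rw [cutKernel_eq γ hδ h.ne, DiffusionKernel.diff, DiffusionKernel.profile,
        indicator_of_mem h1]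
      have h3 : γ.toFun (‖z‖ / δ) ≤ |γ.toFun (r / δ)| :=
        (γ.antitone h2 h1 (div_le_div_of_nonneg_right hz hδ.le)).trans (le_abs_self _)
      gcongr
    · rw [cutKernel_eq_zero γ (not_lt.1 h), zero_mul]
      positivity

/-- A segment leaving Ω is connected, so it meets the frontier, at a point no farther from y than x
is. Thus every pair at distance below δ with one point in Ω lies in the extended domain. -/
theorem mem_extendedDomain_of_near {δ : ℝ} {Ω : Set (Space d)} {x y : Space d} (hx : x ∈ Ω)
    (hxy : ‖y - x‖ < δ) : y ∈ extendedDomain δ Ω := by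
  by_cases hy : y ∈ Ω
  · exact Or.inl hy
  refine Or.inr ⟨?_, hy⟩
  obtain ⟨z, hz, hzf⟩ : (segment ℝ x y ∩ frontier Ω).Nonempty := by
    by_contra hne
    have hcover : segment ℝ x y ⊆ interior Ω ∪ (closure Ω)ᶜ := fun z hz => by
      by_contra hz'
      rw [mem_union, not_or, mem_compl_iff, not_not] at hz'
      exact hne ⟨z, hz, hz'.2, hz'.1⟩
    have hxi : x ∈ interior Ω := (hcover (left_mem_segment ℝ x y)).resolve_right
      fun h => h (subset_closure hx)
    have hyc : y ∈ (closure Ω)ᶜ := (hcover (right_mem_segment ℝ x y)).resolve_left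
      fun h => hy (interior_subset h)
    obtain ⟨z, -, hz1, hz2⟩ := (convex_segment x y).isPreconnected _ _ isOpen_interior
      isClosed_closure.isOpen_compl hcover ⟨x, left_mem_segment ℝ x y, hxi⟩
      ⟨y, right_mem_segment ℝ x y, hyc⟩
    exact hz2 (subset_closure (interior_subset hz1))
  refine Metric.mem_thickening_iff.2 ⟨z, hzf, ?_⟩
  rw [dist_comm]
  have := dist_add_dist_of_mem_segment hz
  have h2 : dist x y < δ := by rwa [dist_comm, dist_eq_norm]
  linarith [dist_nonneg (x := x) (y := z)]

theorem measurableSet_interactionDomain (δ : ℝ) {Ω : Set (Space d)} (hΩ : IsOpen Ω) :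
    MeasurableSet (interactionDomain δ Ω) :=
  Metric.isOpen_thickening.measurableSet.diff hΩ.measurableSet

theorem measurableSet_extendedDomain (δ : ℝ) {Ω : Set (Space d)} (hΩ : IsOpen Ω) :
    MeasurableSet (extendedDomain δ Ω) :=
  hΩ.measurableSet.union (measurableSet_interactionDomain δ hΩ)

theorem ae_norm_sub_ne (hd : 0 < d) {δ : ℝ} (x : Space d) : ∀ᵐ y : Space d, ‖y - x‖ ≠ δ := by
  have : Nonempty (Fin d) := ⟨⟨0, hd⟩⟩
  have : volume (Metric.sphere x δ) = 0 := Measure.addHaar_sphere volume x δ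
  filter_upwards [measure_eq_zero_iff_ae_notMem.1 this] with y hy h
  exact hy (by rw [mem_sphere_iff_norm, h])

/-! ### The energy as an L² norm of weighted increments -/

/-- The weighted increment `√k(y - x) (f(y) - f(x))`. -/
noncomputable def increment (k : Space d → ℝ) (f : Space d → ℝ) (p : Space d × Space d) : ℝ :=
  √(k (p.2 - p.1)) * (f p.2 - f p.1)

theorem measurable_increment {k f : Space d → ℝ} (hk : Measurable k) (hf : Measurable f) :
    Measurable (increment k f) :=
  (hk.comp (measurable_snd.sub measurable_fst)).sqrt.mul
    ((hf.comp measurable_snd).sub (hf.comp measurable_fst))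

theorem increment_mul_increment {k : Space d → ℝ} (hk : ∀ z, 0 ≤ k z) (f g : Space d → ℝ)
    (p : Space d × Space d) :
    increment k f p * increment k g p = k (p.2 - p.1) * (f p.2 - f p.1) * (g p.2 - g p.1) := by
  have := Real.mul_self_sqrt (hk (p.2 - p.1))
  rw [increment, increment]
  linear_combination (f p.2 - f p.1) * (g p.2 - g p.1) * this

/-- Restricting to the extended domain is the same as
using the cut kernel for functions that vanish outside `Ω`. -/
theorem cutKernel_mul_sub (γ : DiffusionKernel d) {δ : ℝ} {Ω : Set (Space d)}
    {f : Space d → ℝ} (hf : ∀ x ∉ Ω, f x = 0) {x y : Space d}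
    (h : ¬(x ∈ extendedDomain δ Ω ∧ y ∈ extendedDomain δ Ω)) :
    cutKernel γ δ (y - x) * (f y - f x) = 0 := by
  rcases lt_or_ge ‖y - x‖ δ with hlt | hge
  · have hx : x ∉ Ω := fun hx => h ⟨Or.inl hx, mem_extendedDomain_of_near hx hlt⟩
    have hy : y ∉ Ω := fun hy =>
      h ⟨mem_extendedDomain_of_near hy (by rwa [norm_sub_rev]), Or.inl hy⟩
    rw [hf x hx, hf y hy, sub_zero, mul_zero]
  · rw [cutKernel_eq_zero γ hge, zero_mul]

theorem energy_eq_lintegral (hd : 0 < d) (γ : DiffusionKernel d) {δ : ℝ} (hδ : 0 < δ)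
    {Ω : Set (Space d)} (hΩ : IsOpen Ω) {f : Space d → ℝ} (hf : ∀ x ∉ Ω, f x = 0)
    (hfm : Measurable f) :
    energy γ δ Ω f = ∫⁻ p, ENNReal.ofReal (increment (cutKernel γ δ) f p ^ 2)
      ∂(volume.prod volume : Measure (Space d × Space d)) := by
  have hk := isSingularKernel_cutKernel hd γ hδ
  rw [lintegral_prod _ ((measurable_increment hk.measurable hfm).pow_const 2).ennreal_ofReal.aemeasurable,
    energy, ← lintegral_indicator (measurableSet_extendedDomain δ hΩ)]
  refine lintegral_congr fun x => ?_
  have key : ∀ y, ENNReal.ofReal (increment (cutKernel γ δ) f (x, y) ^ 2) =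
      ENNReal.ofReal (cutKernel γ δ (y - x) * (f y - f x) * (f y - f x)) := fun y => by
    rw [pow_two, increment_mul_increment hk.nonneg]
  simp_rw [key]
  by_cases hx : x ∈ extendedDomain δ Ω
  · rw [indicator_of_mem hx, ← lintegral_indicator (measurableSet_extendedDomain δ hΩ)]
    refine lintegral_congr_ae ?_
    filter_upwards [ae_norm_sub_ne hd (δ := δ) x] with y hy
    by_cases hy' : y ∈ extendedDomain δ Ω
    · rw [indicator_of_mem hy', energyDensity, cutKernel_eq γ hδ hy, pow_two, mul_assoc]
    · rw [indicator_of_notMem hy', cutKernel_mul_sub γ hf fun h => hy' h.2]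
      simp
  · rw [indicator_of_notMem hx]
    refine (lintegral_eq_zero_of_ae_eq_zero ?_).symm
    filter_upwards with y
    rw [cutKernel_mul_sub γ hf fun h => hx h.1]
    simp

theorem memLp_two_iff_lintegral {α : Type*} [MeasurableSpace α] {μ : Measure α} {F : α → ℝ}
    (hF : AEStronglyMeasurable F μ) :
    MemLp F 2 μ ↔ ∫⁻ p, ENNReal.ofReal (F p ^ 2) ∂μ < ∞ := by
  rw [memLp_two_iff_integrable_sq hF]
  refine ⟨fun h => ?_, fun h => ⟨hF.pow 2, ?_⟩⟩
  · exact (hasFiniteIntegral_iff_ofReal (ae_of_all _ fun p => sq_nonneg (F p))).1 h.2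
  · exact (hasFiniteIntegral_iff_ofReal (ae_of_all _ fun p => sq_nonneg (F p))).2 h

theorem diffusionForm_congr (γ : DiffusionKernel d) (δ : ℝ) (Ω : Set (Space d))
    {u v f g : Space d → ℝ} (hu : u =ᵐ[volume.restrict (extendedDomain δ Ω)] f)
    (hv : v =ᵐ[volume.restrict (extendedDomain δ Ω)] g) :
    diffusionForm γ δ Ω u v = diffusionForm γ δ Ω f g := by
  refine integral_congr_ae ?_
  filter_upwards [hu, hv] with x h1 h2
  refine integral_congr_ae ?_
  filter_upwards [hu, hv] with y h3 h4
  rw [h1, h2, h3, h4]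

/-- It is enough that one of the two functions vanishes off Ω: outside the extended domain the cut
kernel times its increment is already zero. -/
theorem diffusionForm_eq_integral (hd : 0 < d) (γ : DiffusionKernel d) {δ : ℝ} (hδ : 0 < δ)
    {Ω : Set (Space d)} (hΩ : IsOpen Ω) {f g : Space d → ℝ} (hf : ∀ x ∉ Ω, f x = 0)
    (hfi : MemLp (increment (cutKernel γ δ) f) 2 (volume.prod volume))
    (hgi : MemLp (increment (cutKernel γ δ) g) 2 (volume.prod volume)) :
    diffusionForm γ δ Ω f g = ∫ p, increment (cutKernel γ δ) f p * increment (cutKernel γ δ) g p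
      ∂(volume.prod volume : Measure (Space d × Space d)) := by
  have hk := isSingularKernel_cutKernel hd γ hδ
  rw [integral_prod (fun p => _ * _) (hfi.integrable_mul hgi), diffusionForm,
    ← integral_indicator (measurableSet_extendedDomain δ hΩ)]
  refine integral_congr_ae (ae_of_all _ fun x => ?_)
  simp_rw [increment_mul_increment hk.nonneg]
  by_cases hx : x ∈ extendedDomain δ Ω
  · rw [indicator_of_mem hx, ← integral_indicator (measurableSet_extendedDomain δ hΩ)]
    refine integral_congr_ae ?_
    filter_upwards [ae_norm_sub_ne hd (δ := δ) x] with y hy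
    by_cases hy' : y ∈ extendedDomain δ Ω
    · rw [indicator_of_mem hy', cutKernel_eq γ hδ hy]
    · rw [indicator_of_notMem hy', cutKernel_mul_sub γ hf fun h => hy' h.2, zero_mul]
  · rw [indicator_of_notMem hx]
    refine (integral_eq_zero_of_ae ?_).symm
    filter_upwards with y
    rw [cutKernel_mul_sub γ hf fun h => hx h.1, zero_mul]
    rfl

/-! ### The nonlocal Poincaré inequality -/

theorem eLpNorm_two_sq {α : Type*} [MeasurableSpace α] (μ : Measure α) (F : α → ℝ) :
    eLpNorm F 2 μ ^ 2 = ∫⁻ x, ‖F x‖ₑ ^ 2 ∂μ := by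
  have := eLpNorm_nnreal_pow_eq_lintegral (p := 2) (μ := μ) (f := F) (by norm_num)
  simpa using this

/-- Telescoping into n steps of length h, each with the same norm by translation invariance. -/
theorem eLpNorm_translate_sub_le {f : Space d → ℝ} (hf : Measurable f) (h : Space d) (n : ℕ) :
    eLpNorm (fun x => f (x + n • h) - f x) 2 volume ≤
      n * eLpNorm (fun x => f (x + h) - f x) 2 volume := by
  induction n with
  | zero => simp
  | succ n ih =>
    have hm : ∀ a : Space d, Measurable fun x => f (x + a) := fun a =>
      hf.comp (measurable_add_const a)
    have hshift : eLpNorm (fun x => f (x + n • h + h) - f (x + n • h)) 2 volume =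
        eLpNorm (fun x => f (x + h) - f x) 2 volume :=
      eLpNorm_comp_measurePreserving (g := fun x => f (x + h) - f x)
        ((hm h).sub hf).aestronglyMeasurable (measurePreserving_add_right volume (n • h))
    have heq : (fun x => f (x + (n + 1) • h) - f x) =
        (fun x => f (x + n • h + h) - f (x + n • h)) + fun x => f (x + n • h) - f x := by
      funext x
      simp only [Pi.add_apply, succ_nsmul, ← add_assoc]
      ring
    rw [heq]
    have m1 : Measurable fun x => f (x + n • h + h) - f (x + n • h) :=
      ((hm h).comp (measurable_add_const (n • h))).sub (hm _)
    have m2 : Measurable fun x => f (x + n • h) - f x := (hm _).sub hf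
    refine (eLpNorm_add_le m1.aestronglyMeasurable m2.aestronglyMeasurable one_le_two).trans ?_
    rw [hshift, Nat.cast_succ, add_mul, one_mul, add_comm]
    gcongr

theorem enorm_increment_sq {k : Space d → ℝ} (hk : ∀ z, 0 ≤ k z) (f : Space d → ℝ) (x h : Space d) :
    ‖increment k f (x, x + h)‖ₑ ^ 2 = ‖k h‖ₑ * ‖f (x + h) - f x‖ₑ ^ 2 := by
  rw [increment, enorm_mul, mul_pow]
  simp only [add_sub_cancel_left]
  congr 1
  rw [← enorm_pow, Real.sq_sqrt (hk h)]

theorem lintegral_increment_sq {k f : Space d → ℝ} (hk : IsSingularKernel k) (hf : Measurable f) :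
    ∫⁻ p, ‖increment k f p‖ₑ ^ 2 ∂(volume.prod volume : Measure (Space d × Space d)) =
      ∫⁻ h, ‖k h‖ₑ * ∫⁻ x, ‖f (x + h) - f x‖ₑ ^ 2 := by
  have hm : Measurable fun q : Space d × Space d => ‖k q.2‖ₑ * ‖f (q.1 + q.2) - f q.1‖ₑ ^ 2 :=
    (hk.measurable.comp measurable_snd).enorm.mul
      (((hf.comp (measurable_fst.add measurable_snd)).sub (hf.comp measurable_fst)).enorm.pow_const 2)
  rw [lintegral_prod _ ((measurable_increment hk.measurable hf).enorm.pow_const 2).aemeasurable]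
  have h1 : ∀ x, ∫⁻ y, ‖increment k f (x, y)‖ₑ ^ 2 = ∫⁻ h, ‖k h‖ₑ * ‖f (x + h) - f x‖ₑ ^ 2 :=
    fun x => by
      rw [← lintegral_add_left_eq_self (fun y => ‖increment k f (x, y)‖ₑ ^ 2) x]
      exact lintegral_congr fun h => enorm_increment_sq hk.nonneg f x h
  simp_rw [h1]
  rw [lintegral_lintegral_swap hm.aemeasurable]
  refine lintegral_congr fun h => ?_
  refine lintegral_const_mul _ ?_
  exact ((hf.comp (measurable_add_const h)).sub hf).enorm.pow_const 2

/-- The nonlocal Poincaré inequality. -/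
theorem exists_lintegral_poincare (hd : 0 < d) {k : Space d → ℝ} (hk : IsSingularKernel k)
    {Ω : Set (Space d)} (hΩ : Bornology.IsBounded Ω) :
    ∃ C : ℝ≥0∞, C ≠ ∞ ∧ ∀ f : Space d → ℝ, Measurable f → (∀ x ∉ Ω, f x = 0) →
      ∫⁻ x, ‖f x‖ₑ ^ 2 ≤
        C * ∫⁻ p, ‖increment k f p‖ₑ ^ 2 ∂(volume.prod volume : Measure (Space d × Space d)) := by
  obtain ⟨ρ, hρ, c, hc, hkc⟩ := hk.lower
  obtain ⟨R, hR⟩ := hΩ.subset_ball 0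
  -- With n ρ / 2 > 2R, every shift n • h with ‖h‖ > ρ / 2 moves Ω off itself, so f(x) is minus the
  -- increment f(x + n • h) - f(x) for x in Ω. The bound obtained for each h is then averaged over
  -- the annulus ρ / 2 < ‖h‖ < ρ, on which k ≥ c.
  obtain ⟨n, hn⟩ := exists_nat_gt (2 * R / (ρ / 2))
  rw [div_lt_iff₀ (by positivity)] at hn
  let A : Set (Space d) := {z | ρ / 2 < ‖z‖ ∧ ‖z‖ < ρ}
  have hAo : IsOpen A :=
    (isOpen_lt continuous_const continuous_norm).inter (isOpen_lt continuous_norm continuous_const)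
  have : Nonempty (Fin d) := ⟨⟨0, hd⟩⟩
  have hA0 : volume A ≠ 0 := by
    obtain ⟨z, hz⟩ := exists_norm_eq (Space d) (by positivity : (0 : ℝ) ≤ 3 / 4 * ρ)
    exact (hAo.measure_pos volume ⟨z, by constructor <;> rw [hz] <;> linarith⟩).ne'
  have hAt : volume A ≠ ∞ := by
    refine ne_top_of_le_ne_top (measure_ball_lt_top (μ := volume) (x := (0 : Space d)) (r := ρ)).ne
      (measure_mono fun z hz => ?_)
    simpa using hz.2
  refine ⟨(volume A)⁻¹ * (n ^ 2 * (ENNReal.ofReal c)⁻¹), ?_, fun f hf hf0 => ?_⟩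
  · exact ENNReal.mul_ne_top (ENNReal.inv_ne_top.2 hA0) (ENNReal.mul_ne_top (by simp)
      (ENNReal.inv_ne_top.2 (by simpa using hc)))
  have hpt : ∀ h ∈ A, ∫⁻ x, ‖f x‖ₑ ^ 2 ≤ n ^ 2 * ∫⁻ x, ‖f (x + h) - f x‖ₑ ^ 2 := fun h hh => by
    rw [← eLpNorm_two_sq, ← eLpNorm_two_sq, ← mul_pow]
    refine pow_le_pow_left' ((eLpNorm_mono fun x => ?_).trans (eLpNorm_translate_sub_le hf h n)) 2
    by_cases hx : x ∈ Ω
    · have hxh : x + n • h ∉ Ω := fun hxh => by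
        have h1 : ‖x‖ < R := by simpa using hR hx
        have h2 : ‖x + n • h‖ < R := by simpa using hR hxh
        have h3 : ‖n • h‖ ≤ ‖x + n • h‖ + ‖x‖ := by
          have := norm_sub_le (x + n • h) x
          rwa [add_sub_cancel_left] at this
        have h4 : ‖n • h‖ = n * ‖h‖ := by
          rw [← Nat.cast_smul_eq_nsmul ℝ, norm_smul, Real.norm_natCast]
        have h5 : (n : ℝ) * (ρ / 2) ≤ n * ‖h‖ := mul_le_mul_of_nonneg_left hh.1.le n.cast_nonneg
        linarith
      rw [hf0 _ hxh, zero_sub, norm_neg]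
    · rw [hf0 x hx, norm_zero]
      exact norm_nonneg _
  have hint : volume A * ∫⁻ x, ‖f x‖ₑ ^ 2 ≤ n ^ 2 * (ENNReal.ofReal c)⁻¹ *
      ∫⁻ h, ‖k h‖ₑ * ∫⁻ x, ‖f (x + h) - f x‖ₑ ^ 2 := by
    calc volume A * ∫⁻ x, ‖f x‖ₑ ^ 2 = ∫⁻ _ in A, ∫⁻ x, ‖f x‖ₑ ^ 2 := by
          rw [setLIntegral_const, mul_comm]
      _ ≤ ∫⁻ h in A, n ^ 2 * (ENNReal.ofReal c)⁻¹ *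
            (‖k h‖ₑ * ∫⁻ x, ‖f (x + h) - f x‖ₑ ^ 2) := by
          refine setLIntegral_mono' hAo.measurableSet fun h hh => (hpt h hh).trans ?_
          rw [mul_assoc, ← mul_assoc (ENNReal.ofReal c)⁻¹]
          gcongr
          refine le_mul_of_one_le_left zero_le ?_
          rw [mul_comm, ← div_eq_mul_inv, ENNReal.le_div_iff_mul_le (by simp [hc]) (by simp), one_mul,
            ← ofReal_norm, Real.norm_of_nonneg (hk.nonneg h)]
          exact ENNReal.ofReal_le_ofReal (hkc h (by linarith [hh.1]) hh.2)
      _ ≤ ∫⁻ h, n ^ 2 * (ENNReal.ofReal c)⁻¹ * (‖k h‖ₑ * ∫⁻ x, ‖f (x + h) - f x‖ₑ ^ 2) :=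
          setLIntegral_le_lintegral _ _
      _ = _ := by
          refine lintegral_const_mul' _ _ ?_
          exact ENNReal.mul_ne_top (by simp) (ENNReal.inv_ne_top.2 (by simpa using hc))
  rw [lintegral_increment_sq hk hf, mul_assoc, ← ENNReal.div_eq_inv_mul,
    ENNReal.le_div_iff_mul_le (Or.inl hA0) (Or.inl hAt), mul_comm]
  exact hint

theorem ofReal_integral_sq {α : Type*} [MeasurableSpace α] {μ : Measure α} {F : α → ℝ}
    (hF : MemLp F 2 μ) : ENNReal.ofReal (∫ x, F x ^ 2 ∂μ) = ∫⁻ x, ‖F x‖ₑ ^ 2 ∂μ := by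
  rw [ofReal_integral_eq_lintegral_ofReal ((memLp_two_iff_integrable_sq hF.1).1 hF)
    (ae_of_all _ fun x => sq_nonneg _)]
  refine lintegral_congr fun x => ?_
  rw [← enorm_pow, ← ofReal_norm, Real.norm_of_nonneg (sq_nonneg _)]

theorem exists_poincare (hd : 0 < d) {k : Space d → ℝ} (hk : IsSingularKernel k)
    {Ω : Set (Space d)} (hΩ : Bornology.IsBounded Ω) :
    ∃ C : ℝ, 0 < C ∧ ∀ f : Space d → ℝ, Measurable f → (∀ x ∉ Ω, f x = 0) → MemLp f 2 volume →
      MemLp (increment k f) 2 (volume.prod volume) →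
      ∫ x, f x ^ 2 ≤
        C * ∫ p, increment k f p ^ 2 ∂(volume.prod volume : Measure (Space d × Space d)) := by
  obtain ⟨C, hC, h⟩ := exists_lintegral_poincare hd hk hΩ
  refine ⟨C.toReal + 1, by positivity, fun f hf hf0 hf2 hfi => ?_⟩
  have hI : 0 ≤ ∫ p, increment k f p ^ 2 ∂(volume.prod volume : Measure (Space d × Space d)) :=
    integral_nonneg fun p => sq_nonneg _
  have := h f hf hf0
  rw [← ofReal_integral_sq hf2, ← ofReal_integral_sq hfi, ← ENNReal.ofReal_toReal hC,
    ← ENNReal.ofReal_mul ENNReal.toReal_nonneg,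
    ENNReal.ofReal_le_ofReal_iff (mul_nonneg ENNReal.toReal_nonneg hI)] at this
  linarith

/-! ### The energy space as a closed subspace of L² of the product -/

/-- Measurable square integrable functions of finite energy that vanish outside `Ω`. -/
structure IsAdmissible (k : Space d → ℝ) (Ω : Set (Space d)) (f : Space d → ℝ) : Prop where
  measurable : Measurable f
  zero_off : ∀ x ∉ Ω, f x = 0
  memLp : MemLp f 2 volume
  increment_memLp : MemLp (increment k f) 2 (volume.prod volume)

theorem increment_congr {k f g : Space d → ℝ} (h : f =ᵐ[volume] g) :
    increment k f =ᵐ[volume.prod volume] increment k g := by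
  filter_upwards [(Measure.quasiMeasurePreserving_fst (μ := volume) (ν := volume)).ae h,
    (Measure.quasiMeasurePreserving_snd (μ := volume) (ν := volume)).ae h] with p h1 h2
  rw [increment, increment, h1, h2]

theorem increment_add (k f g : Space d → ℝ) :
    increment k (f + g) = increment k f + increment k g := by
  funext p
  simp only [increment, Pi.add_apply]
  ring

theorem increment_smul (k f : Space d → ℝ) (c : ℝ) :
    increment k (c • f) = c • increment k f := by
  funext p
  simp only [increment, Pi.smul_apply, smul_eq_mul]
  ring

/-- The extension by zero of a function on `Ω`. -/
noncomputable def zeroExt (Ω : Set (Space d)) (u : Space d → ℝ) : Space d → ℝ := Ω.indicator u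

theorem inner_toLp {α : Type*} [MeasurableSpace α] {μ : Measure α} {f g : α → ℝ}
    (hf : MemLp f 2 μ) (hg : MemLp g 2 μ) :
    ⟪hf.toLp f, hg.toLp g⟫ = ∫ x, f x * g x ∂μ := by
  rw [L2.inner_def]
  refine integral_congr_ae ?_
  filter_upwards [hf.coeFn_toLp, hg.coeFn_toLp] with x h1 h2
  rw [h1, h2]
  simp [mul_comm]

theorem norm_toLp_sq {α : Type*} [MeasurableSpace α] {μ : Measure α} {f : α → ℝ}
    (hf : MemLp f 2 μ) : ‖hf.toLp f‖ ^ 2 = ∫ x, f x ^ 2 ∂μ := by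
  rw [← real_inner_self_eq_norm_sq, inner_toLp]
  simp_rw [pow_two]

section EnergyMap

variable (hd : 0 < d) (γ : DiffusionKernel d) {δ : ℝ} (hδ : 0 < δ) {Ω : Set (Space d)}
  (hΩ : IsOpen Ω)

include hΩ in
theorem zeroExt_ae_eq (u : energySpace γ δ Ω) :
    u.1 =ᵐ[volume.restrict (extendedDomain δ Ω)] zeroExt Ω u.1 := by
  refine (ae_restrict_union_iff _ _ _).2 ⟨?_, ?_⟩
  · filter_upwards [ae_restrict_mem hΩ.measurableSet] with x hx
    rw [zeroExt, indicator_of_mem hx]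
  · filter_upwards [u.2.2, ae_restrict_mem (measurableSet_interactionDomain δ hΩ)] with x hx hx'
    rw [zeroExt, indicator_of_notMem hx'.2, hx]

include hΩ in
theorem zeroExt_congr {u : Lp ℝ 2 (volume.restrict (extendedDomain δ Ω))} {f : Space d → ℝ}
    (h : u =ᵐ[volume.restrict (extendedDomain δ Ω)] f) :
    zeroExt Ω u =ᵐ[volume] zeroExt Ω f := by
  have h' : u =ᵐ[volume.restrict Ω] f := ae_mono (Measure.restrict_mono subset_union_left le_rfl) h
  filter_upwards [(ae_restrict_iff' hΩ.measurableSet).1 h'] with x hx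
  by_cases hxΩ : x ∈ Ω
  · simp only [zeroExt, indicator_of_mem hxΩ, hx hxΩ]
  · simp only [zeroExt, indicator_of_notMem hxΩ]

include hd hδ hΩ in
theorem isAdmissible_zeroExt (u : energySpace γ δ Ω) :
    IsAdmissible (cutKernel γ δ) Ω (zeroExt Ω u.1) := by
  have hm : Measurable (zeroExt Ω u.1) :=
    (Lp.stronglyMeasurable u.1).measurable.indicator hΩ.measurableSet
  have h0 : ∀ x ∉ Ω, zeroExt Ω u.1 x = 0 := fun x hx => indicator_of_notMem hx _
  refine ⟨hm, h0, ?_, ?_⟩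
  · refine (memLp_indicator_iff_restrict hΩ.measurableSet).2 ?_
    exact (Lp.memLp u.1).mono_measure (Measure.restrict_mono subset_union_left le_rfl)
  · rw [memLp_two_iff_lintegral (measurable_increment
      (isSingularKernel_cutKernel hd γ hδ).measurable hm).aestronglyMeasurable,
      ← energy_eq_lintegral hd γ hδ hΩ h0 hm, ← energy_congr γ δ Ω (zeroExt_ae_eq γ hΩ u)]
    exact u.2.1

-- Supplies the elements of the energy space that are built as functions: limits, in the proof that
-- the range is closed, and excesses, in the maximum principle.
include hd hδ hΩ in
theorem exists_of_isAdmissible {f : Space d → ℝ} (hf : IsAdmissible (cutKernel γ δ) Ω f) :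
    ∃ u : energySpace γ δ Ω, zeroExt Ω u.1 =ᵐ[volume] f := by
  have hr : MemLp f 2 (volume.restrict (extendedDomain δ Ω)) := hf.memLp.restrict _
  have hu := hr.coeFn_toLp
  have hz : zeroExt Ω f = f := by
    funext x
    by_cases hx : x ∈ Ω
    · exact indicator_of_mem hx _
    · rw [hf.zero_off x hx]
      exact indicator_of_notMem hx _
  refine ⟨⟨hr.toLp f, ?_, ?_⟩, ?_⟩
  · rw [energy_congr γ δ Ω hu, energy_eq_lintegral hd γ hδ hΩ hf.zero_off hf.measurable]
    exact (memLp_two_iff_lintegral hf.increment_memLp.1).1 hf.increment_memLp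
  · have := ae_mono (Measure.restrict_mono (subset_union_right (s := Ω)) le_rfl) hu
    filter_upwards [this, ae_restrict_mem (measurableSet_interactionDomain δ hΩ)] with x hx hx'
    rw [hx, hf.zero_off x hx'.2]
  · have := zeroExt_congr hΩ hu
    rwa [hz] at this

/-- Extension by zero as a linear map into `L²` of the whole space. -/
noncomputable def extensionMap : energySpace γ δ Ω →ₗ[ℝ] Lp ℝ 2 (volume : Measure (Space d)) where
  toFun u := (isAdmissible_zeroExt hd γ hδ hΩ u).memLp.toLp _
  map_add' u v := by
    rw [← MemLp.toLp_add, MemLp.toLp_eq_toLp_iff]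
    refine (zeroExt_congr hΩ (Lp.coeFn_add u.1 v.1)).trans (ae_of_all _ fun x => ?_)
    exact congrFun (indicator_add Ω (u.1 : Space d → ℝ) v.1) x
  map_smul' c u := by
    rw [RingHom.id_apply, ← MemLp.toLp_const_smul, MemLp.toLp_eq_toLp_iff]
    refine (zeroExt_congr hΩ (Lp.coeFn_smul c u.1)).trans (ae_of_all _ fun x => ?_)
    exact congrFun (indicator_const_smul Ω c (u.1 : Space d → ℝ)) x

theorem extensionMap_ae (u : energySpace γ δ Ω) :
    extensionMap hd γ hδ hΩ u =ᵐ[volume] zeroExt Ω u.1 :=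
  (isAdmissible_zeroExt hd γ hδ hΩ u).memLp.coeFn_toLp

/-- The map sending a function to its weighted increments, an isometry for the energy norm. -/
noncomputable def energyMap : energySpace γ δ Ω →ₗ[ℝ]
    Lp ℝ 2 (volume.prod volume : Measure (Space d × Space d)) where
  toFun u := (isAdmissible_zeroExt hd γ hδ hΩ u).increment_memLp.toLp _
  map_add' u v := by
    rw [← MemLp.toLp_add, MemLp.toLp_eq_toLp_iff, ← increment_add]
    refine increment_congr ((zeroExt_congr hΩ (Lp.coeFn_add u.1 v.1)).trans (ae_of_all _ fun x => ?_))
    exact congrFun (indicator_add Ω (u.1 : Space d → ℝ) v.1) x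
  map_smul' c u := by
    rw [RingHom.id_apply, ← MemLp.toLp_const_smul, MemLp.toLp_eq_toLp_iff, ← increment_smul]
    refine increment_congr ((zeroExt_congr hΩ (Lp.coeFn_smul c u.1)).trans (ae_of_all _ fun x => ?_))
    exact congrFun (indicator_const_smul Ω c (u.1 : Space d → ℝ)) x

theorem energyMap_ae (u : energySpace γ δ Ω) :
    energyMap hd γ hδ hΩ u =ᵐ[volume.prod volume] increment (cutKernel γ δ) (zeroExt Ω u.1) :=
  (isAdmissible_zeroExt hd γ hδ hΩ u).increment_memLp.coeFn_toLp

theorem inner_energyMap (u v : energySpace γ δ Ω) :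
    ⟪energyMap hd γ hδ hΩ u, energyMap hd γ hδ hΩ v⟫ = diffusionForm γ δ Ω u.1 v.1 := by
  have hu := isAdmissible_zeroExt hd γ hδ hΩ u
  rw [diffusionForm_congr γ δ Ω (zeroExt_ae_eq γ hΩ u) (zeroExt_ae_eq γ hΩ v),
    diffusionForm_eq_integral hd γ hδ hΩ hu.zero_off hu.increment_memLp
      (isAdmissible_zeroExt hd γ hδ hΩ v).increment_memLp]
  exact inner_toLp hu.increment_memLp (isAdmissible_zeroExt hd γ hδ hΩ v).increment_memLp

theorem energyNorm_eq (u : energySpace γ δ Ω) :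
    energyNorm γ δ Ω u = ‖energyMap hd γ hδ hΩ u‖ := by
  rw [energyNorm, ← inner_energyMap hd γ hδ hΩ, norm_eq_sqrt_real_inner]

theorem eq_zero_of_extensionMap (u : energySpace γ δ Ω) (h : extensionMap hd γ hδ hΩ u = 0) :
    u = 0 := by
  have h1 : zeroExt Ω u.1 =ᵐ[volume] 0 :=
    (extensionMap_ae hd γ hδ hΩ u).symm.trans (by rw [h]; exact Lp.coeFn_zero ℝ 2 _)
  refine Subtype.ext (Lp.ext ?_)
  exact ((zeroExt_ae_eq γ hΩ u).trans (ae_restrict_of_ae h1)).trans (Lp.coeFn_zero ℝ 2 _).symm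

theorem exists_norm_extensionMap_le (hΩb : Bornology.IsBounded Ω) :
    ∃ C : ℝ, 0 < C ∧ ∀ u : energySpace γ δ Ω,
      ‖extensionMap hd γ hδ hΩ u‖ ≤ C * ‖energyMap hd γ hδ hΩ u‖ := by
  obtain ⟨C, hC, h⟩ := exists_poincare hd (isSingularKernel_cutKernel hd γ hδ) hΩb
  refine ⟨√C, Real.sqrt_pos.2 hC, fun u => ?_⟩
  have hu := isAdmissible_zeroExt hd γ hδ hΩ u
  have := h _ hu.measurable hu.zero_off hu.memLp hu.increment_memLp
  rw [← norm_toLp_sq hu.memLp, ← norm_toLp_sq hu.increment_memLp] at this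
  refine (sq_le_sq₀ (norm_nonneg _) (by positivity)).1 ?_
  rw [mul_pow, Real.sq_sqrt hC.le]
  exact this

theorem energyMap_injective (hΩb : Bornology.IsBounded Ω) :
    Function.Injective (energyMap hd γ hδ hΩ) := by
  obtain ⟨C, -, h⟩ := exists_norm_extensionMap_le hd γ hδ hΩ hΩb
  refine (injective_iff_map_eq_zero _).2 fun u hu => eq_zero_of_extensionMap hd γ hδ hΩ u ?_
  have := h u
  rw [hu, norm_zero, mul_zero] at this
  exact norm_le_zero_iff.1 this

/-- If the increments converge in L², then by Poincaré the functions are Cauchy in L². The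
increments of their limit are the limit of the increments, as almost everywhere convergence along a
subsequence shows. -/
theorem isClosed_range_energyMap (hΩb : Bornology.IsBounded Ω) :
    IsClosed (LinearMap.range (energyMap hd γ hδ hΩ) :
      Set (Lp ℝ 2 (volume.prod volume : Measure (Space d × Space d)))) := by
  obtain ⟨C, hC, hP⟩ := exists_norm_extensionMap_le hd γ hδ hΩ hΩb
  refine IsSeqClosed.isClosed fun F G hF hFG => ?_
  choose u hu using hF
  have hcau : CauchySeq fun n => extensionMap hd γ hδ hΩ (u n) := by
    refine Metric.cauchySeq_iff.2 fun θ hθ => ?_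
    obtain ⟨N, hN⟩ := Metric.cauchySeq_iff.1 hFG.cauchySeq (θ / C) (div_pos hθ hC)
    refine ⟨N, fun m hm n hn => ?_⟩
    have := hN m hm n hn
    rw [dist_eq_norm, ← hu, ← hu, ← map_sub, lt_div_iff₀ hC, mul_comm] at this
    rw [dist_eq_norm, ← map_sub]
    exact (hP _).trans_lt this
  obtain ⟨g, hg⟩ := cauchySeq_tendsto_of_complete hcau
  obtain ⟨ns, hns, hgae⟩ := (tendstoInMeasure_of_tendsto_Lp hg).exists_seq_tendsto_ae
  -- Extracted from the first subsequence, so that functions and increments converge almost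
  -- everywhere along the same indices.
  obtain ⟨ms, hms, hGae⟩ := (tendstoInMeasure_of_tendsto_Lp
    (hFG.comp hns.tendsto_atTop)).exists_seq_tendsto_ae
  have hgae' : ∀ᵐ x : Space d,
      Tendsto (fun i => zeroExt Ω (u (ns (ms i))).1 x) atTop (𝓝 (g x)) := by
    filter_upwards [hgae, ae_all_iff.2 fun i => extensionMap_ae hd γ hδ hΩ (u i)] with x hx hx'
    exact (hx.comp hms.tendsto_atTop).congr fun i => hx' _
  have hGae' : ∀ᵐ p ∂(volume.prod volume : Measure (Space d × Space d)),
      Tendsto (fun i => increment (cutKernel γ δ) (zeroExt Ω (u (ns (ms i))).1) p) atTop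
        (𝓝 (G p)) := by
    filter_upwards [hGae, ae_all_iff.2 fun i => energyMap_ae hd γ hδ hΩ (u i)] with p hp hp'
    refine hp.congr fun i => ?_
    rw [← hp']
    simp only [Function.comp_apply, hu]
  -- The limit g vanishes off Ω only almost everywhere; f is a representative that vanishes there
  -- everywhere.
  let f : Space d → ℝ := zeroExt Ω g
  have hfg : f =ᵐ[volume] g := by
    filter_upwards [hgae'] with x hx
    by_cases hxΩ : x ∈ Ω
    · exact indicator_of_mem hxΩ _
    · have : ∀ i, zeroExt Ω (u (ns (ms i))).1 x = 0 := fun i => indicator_of_notMem hxΩ _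
      simp_rw [this] at hx
      rw [tendsto_nhds_unique hx tendsto_const_nhds]
      exact indicator_of_notMem hxΩ _
  have hlim : increment (cutKernel γ δ) g =ᵐ[volume.prod volume] G := by
    filter_upwards [hGae',
      (Measure.quasiMeasurePreserving_fst (μ := volume) (ν := volume)).ae hgae',
      (Measure.quasiMeasurePreserving_snd (μ := volume) (ν := volume)).ae hgae'] with p h1 h2 h3
    exact tendsto_nhds_unique ((h3.sub h2).const_mul _) h1
  have hf : IsAdmissible (cutKernel γ δ) Ω f :=
    ⟨(Lp.stronglyMeasurable g).measurable.indicator hΩ.measurableSet,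
      fun x hx => indicator_of_notMem hx _, (memLp_congr_ae hfg).2 (Lp.memLp g),
      (memLp_congr_ae ((increment_congr hfg).trans hlim)).2 (Lp.memLp G)⟩
  obtain ⟨w, hw⟩ := exists_of_isAdmissible hd γ hδ hΩ hf
  refine ⟨w, Lp.ext ?_⟩
  exact (energyMap_ae hd γ hδ hΩ w).trans
    ((increment_congr (hw.trans hfg)).trans hlim)

end EnergyMap

/-! ### Drift coefficients and boundedness of the convection term -/

theorem measurePreserving_sub_left :
    MeasurePreserving (fun p : Space d × Space d => (p.1, p.2 - p.1))
      (volume.prod volume) (volume.prod volume) := by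
  have := measurePreserving_prod_neg_add (volume : Measure (Space d)) (volume : Measure (Space d))
  simpa only [neg_add_eq_sub] using this

theorem integral_comp_sub_left {F : Space d × Space d → ℝ}
    (hF : AEStronglyMeasurable F (volume.prod volume)) :
    ∫ p, F (p.1, p.2 - p.1) ∂(volume.prod volume : Measure (Space d × Space d)) =
      ∫ p, F p ∂(volume.prod volume) := by
  conv_rhs => rw [← (measurePreserving_sub_left (d := d)).map_eq]
  rw [integral_map measurePreserving_sub_left.measurable.aemeasurable]
  rwa [measurePreserving_sub_left.map_eq]

/-- A weight whose square is dominated by an integrable function of the difference acts boundedly. -/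
theorem memLp_weight_mul {m : Space d × Space d → ℝ} (hm : Measurable m) {w : Space d → ℝ}
    (hw : Integrable w) (hmw : ∀ p, m p ^ 2 ≤ w (p.2 - p.1)) {F : Space d → ℝ}
    (hF : MemLp F 2 volume) :
    MemLp (fun p : Space d × Space d => m p * F p.1) 2 (volume.prod volume) ∧
      ∫ p, (m p * F p.1) ^ 2 ∂(volume.prod volume : Measure (Space d × Space d)) ≤
        (∫ z, w z) * ∫ x, F x ^ 2 := by
  have hT : Integrable (fun p : Space d × Space d => F p.1 ^ 2 * w p.2) (volume.prod volume) :=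
    ((memLp_two_iff_integrable_sq hF.1).1 hF).mul_prod hw
  have hT' : Integrable (fun p : Space d × Space d => F p.1 ^ 2 * w (p.2 - p.1))
      (volume.prod volume) := measurePreserving_sub_left.integrable_comp_of_integrable hT
  have hmeas : AEStronglyMeasurable (fun p : Space d × Space d => m p * F p.1)
      (volume.prod volume) := hm.aestronglyMeasurable.mul hF.1.comp_fst
  have hle : ∀ p : Space d × Space d, (m p * F p.1) ^ 2 ≤ F p.1 ^ 2 * w (p.2 - p.1) := fun p => by
    rw [mul_pow, mul_comm]
    exact mul_le_mul_of_nonneg_left (hmw p) (sq_nonneg _)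
  have hsq : Integrable (fun p : Space d × Space d => (m p * F p.1) ^ 2) (volume.prod volume) :=
    hT'.mono' (hmeas.pow 2) (ae_of_all _ fun p => by
      rw [Real.norm_of_nonneg (sq_nonneg _)]
      exact hle p)
  refine ⟨(memLp_two_iff_integrable_sq hmeas).2 hsq, (integral_mono hsq hT' hle).trans_eq ?_⟩
  rw [integral_comp_sub_left (F := fun p => F p.1 ^ 2 * w p.2) hT.1,
    integral_prod_mul (fun x => F x ^ 2) w, mul_comm]

/-- Multiplication by a weight on pairs of points, as a map from `L²` to `L²` of the product. -/
noncomputable def weightMap (m : Space d × Space d → ℝ)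
    (hm : ∀ F : Space d → ℝ, MemLp F 2 volume →
      MemLp (fun p : Space d × Space d => m p * F p.1) 2 (volume.prod volume)) :
    Lp ℝ 2 (volume : Measure (Space d)) →ₗ[ℝ]
      Lp ℝ 2 (volume.prod volume : Measure (Space d × Space d)) where
  toFun F := (hm F (Lp.memLp F)).toLp _
  map_add' F G := by
    rw [← MemLp.toLp_add, MemLp.toLp_eq_toLp_iff]
    filter_upwards [(Measure.quasiMeasurePreserving_fst (μ := volume) (ν := volume)).ae
      (Lp.coeFn_add F G)] with p hp
    rw [hp, Pi.add_apply, Pi.add_apply, mul_add]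
  map_smul' c F := by
    rw [RingHom.id_apply, ← MemLp.toLp_const_smul, MemLp.toLp_eq_toLp_iff]
    filter_upwards [(Measure.quasiMeasurePreserving_fst (μ := volume) (ν := volume)).ae
      (Lp.coeFn_smul c F)] with p hp
    rw [hp, Pi.smul_apply, Pi.smul_apply, smul_eq_mul, smul_eq_mul, mul_left_comm]

/-- The weight `√k(y - x) q(x, y)` that represents a drift with coefficient `q`. -/
noncomputable def driftWeight (k : Space d → ℝ) (q : Space d × Space d → ℝ)
    (p : Space d × Space d) : ℝ := √(k (p.2 - p.1)) * q p

theorem measurable_driftWeight {k : Space d → ℝ} (hk : Measurable k) {q : Space d × Space d → ℝ}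
    (hq : Measurable q) : Measurable (driftWeight k q) :=
  (hk.comp (measurable_snd.sub measurable_fst)).sqrt.mul hq

theorem driftWeight_sq_le {k : Space d → ℝ} (hk : ∀ z, 0 ≤ k z) {q : Space d × Space d → ℝ}
    {C : ℝ} {p : Space d × Space d} (hq : |q p| ≤ C * ‖p.2 - p.1‖) :
    driftWeight k q p ^ 2 ≤ C ^ 2 * (k (p.2 - p.1) * ‖p.2 - p.1‖ ^ 2) := by
  have h1 : q p ^ 2 ≤ (C * ‖p.2 - p.1‖) ^ 2 := by
    rw [← sq_abs]
    exact pow_le_pow_left₀ (abs_nonneg _) hq 2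
  rw [driftWeight, mul_pow, Real.sq_sqrt (hk _)]
  calc k (p.2 - p.1) * q p ^ 2 ≤ k (p.2 - p.1) * (C * ‖p.2 - p.1‖) ^ 2 :=
        mul_le_mul_of_nonneg_left h1 (hk _)
    _ = _ := by ring

theorem increment_mul_driftWeight {k : Space d → ℝ} (hk : ∀ z, 0 ≤ k z) (f : Space d → ℝ)
    (q : Space d × Space d → ℝ) (t : ℝ) (p : Space d × Space d) :
    increment k f p * (driftWeight k q p * t) =
      k (p.2 - p.1) * q p * ((f p.2 - f p.1) * t) := by
  have := Real.mul_self_sqrt (hk (p.2 - p.1))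
  rw [increment, driftWeight]
  linear_combination (f p.2 - f p.1) * q p * t * this

/-- The drift coefficient grows at most linearly in the distance of the two points. -/
structure IsDrift (C : ℝ) (q : Space d × Space d → ℝ) : Prop where
  measurable : Measurable q
  bound : ∀ p, |q p| ≤ C * ‖p.2 - p.1‖

theorem IsDrift.weight {k : Space d → ℝ} (hk : IsSingularKernel k) {C : ℝ}
    {q : Space d × Space d → ℝ} (hq : IsDrift C q) {F : Space d → ℝ} (hF : MemLp F 2 volume) :
    MemLp (fun p : Space d × Space d => driftWeight k q p * F p.1) 2 (volume.prod volume) ∧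
      ∫ p, (driftWeight k q p * F p.1) ^ 2 ∂(volume.prod volume : Measure (Space d × Space d)) ≤
        (∫ z, C ^ 2 * (k z * ‖z‖ ^ 2)) * ∫ x, F x ^ 2 :=
  memLp_weight_mul (measurable_driftWeight hk.measurable hq.measurable)
    (hk.moment.const_mul (C ^ 2)) (fun p => driftWeight_sq_le hk.nonneg (hq.bound p)) hF

theorem IsDrift.integrable {k : Space d → ℝ} (hk : IsSingularKernel k) {C : ℝ}
    {q : Space d × Space d → ℝ} (hq : IsDrift C q) {f g : Space d → ℝ}
    (hf : MemLp (increment k f) 2 (volume.prod volume)) (hg : MemLp g 2 volume) :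
    Integrable (fun p : Space d × Space d =>
      k (p.2 - p.1) * q p * ((f p.2 - f p.1) * g p.1)) (volume.prod volume) :=
  (hf.integrable_mul (hq.weight hk hg).1).congr (ae_of_all _ fun p =>
    increment_mul_driftWeight hk.nonneg f q (g p.1) p)

/-- The factor r cancels the normalization of the direction (y - x) / |y - x|. This is why
convection is the diffusion kernel times a drift coefficient linear in y - x. -/
theorem DiffusionKernel.conv_eq (γ : DiffusionKernel d) (η : ℝ) {δ : ℝ} (hδ : 0 < δ) (r : ℝ) :
    γ.conv η δ r = η⁻¹ * (r * γ.diff δ r) := by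
  simp only [conv, convProfile, diff]
  field_simp
  ring

section Convection

variable (hd : 0 < d) (γ : DiffusionKernel d) {δ : ℝ} (hδ : 0 < δ) {Ω : Set (Space d)}
  (hΩ : IsOpen Ω)

include hd hδ hΩ in
/-- The nonlocal gradient of an element of the energy space, tested against the velocity. -/
theorem inner_nonlocalGradient {η : ℝ} {b : Space d → Space d} {H : Space d → Set (Space d)}
    {q : Space d × Space d → ℝ} (hH : ∀ x, H x ⊆ Metric.ball x δ) (hHm : ∀ x, MeasurableSet (H x))
    (hbq : ∀ᵐ x ∂volume.restrict Ω, ∀ y, q (x, y) = (H x).indicator (fun y => η⁻¹ * ⟪b x, y - x⟫) y)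
    (u : energySpace γ δ Ω) :
    ∀ᵐ x ∂volume.restrict Ω, ⟪b x, nonlocalGradient γ η δ H u.1 x⟫ =
      ∫ y, cutKernel γ δ (y - x) * q (x, y) * (zeroExt Ω u.1 y - zeroExt Ω u.1 x) := by
  have hk := isSingularKernel_cutKernel hd γ hδ
  have hu := isAdmissible_zeroExt hd γ hδ hΩ u
  set f := zeroExt Ω u.1 with hf
  have hinc : ∀ᵐ x : Space d, Integrable fun y => increment (cutKernel γ δ) f (x, y) ^ 2 :=
    ((memLp_two_iff_integrable_sq hu.increment_memLp.1).1 hu.increment_memLp).prod_right_ae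
  have hfu := (ae_restrict_iff' (measurableSet_extendedDomain δ hΩ)).1 (zeroExt_ae_eq γ hΩ u)
  filter_upwards [ae_restrict_of_ae hinc, hbq, ae_restrict_mem hΩ.measurableSet] with x hx hbx hxΩ
  let V : Space d → Space d := fun y => (η⁻¹ * (cutKernel γ δ (y - x) * (f y - f x))) • (y - x)
  have hVm : Measurable V :=
    (((hk.measurable.comp (measurable_id.sub_const x)).mul (hu.measurable.sub_const _)).const_mul
      _).smul (measurable_id.sub_const x)
  have hV : Integrable V := by
    have hdom : Integrable fun y => |η⁻¹| *
        (cutKernel γ δ (y - x) * ‖y - x‖ ^ 2 + increment (cutKernel γ δ) f (x, y) ^ 2) :=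
      ((hk.moment.comp_sub_right x).add hx).const_mul _
    refine hdom.mono' hVm.aestronglyMeasurable (ae_of_all _ fun y => ?_)
    have hinc2 : increment (cutKernel γ δ) f (x, y) ^ 2 =
        cutKernel γ δ (y - x) * (f y - f x) * (f y - f x) := by
      rw [pow_two, increment_mul_increment hk.nonneg]
    rw [hinc2, norm_smul, norm_mul, norm_mul, Real.norm_of_nonneg (hk.nonneg _), mul_assoc,
      Real.norm_eq_abs, Real.norm_eq_abs]
    refine mul_le_mul_of_nonneg_left ?_ (abs_nonneg _)
    -- Multiplied by k, both terms on the right are integrable in y: one by the second moment, the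
    -- other by finite energy for almost every x.
    have h1 : |f y - f x| * ‖y - x‖ ≤ ‖y - x‖ ^ 2 + (f y - f x) ^ 2 := by
      rw [← sq_abs (f y - f x)]
      nlinarith [sq_nonneg (|f y - f x| - ‖y - x‖), abs_nonneg (f y - f x), norm_nonneg (y - x)]
    nlinarith [mul_le_mul_of_nonneg_left h1 (hk.nonneg (y - x))]
  have hgrad : nonlocalGradient γ η δ H u.1 x = ∫ y in H x, V y := by
    refine setIntegral_congr_ae (hHm x) ?_
    filter_upwards [hfu] with y hy hyH
    have hyx : ‖y - x‖ < δ := by simpa [dist_eq_norm] using hH x hyH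
    have hfx : u.1 x = f x := (indicator_of_mem hxΩ _).symm
    rw [hy (mem_extendedDomain_of_near hxΩ hyx), hfx, ← hf, γ.conv_eq η hδ, smul_smul]
    simp only [V, cutKernel_eq γ hδ hyx.ne]
    rcases eq_or_ne y x with rfl | hne
    · simp
    · have : ‖y - x‖ ≠ 0 := norm_ne_zero_iff.2 (sub_ne_zero.2 hne)
      congr 1
      field_simp
  rw [hgrad, ← integral_indicator (hHm x),
    ← integral_inner ((integrable_indicator_iff (hHm x)).2 hV.integrableOn)]
  refine integral_congr_ae (ae_of_all _ fun y => ?_)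
  simp only [hbx y]
  by_cases hy : y ∈ H x
  · simp only [indicator_of_mem hy, V, real_inner_smul_right]
    ring
  · simp [indicator_of_notMem hy]

include hd hδ hΩ in
theorem convection_eq_integral {η C : ℝ} {b : Space d → Space d} {H : Space d → Set (Space d)}
    {q : Space d × Space d → ℝ} (hH : ∀ x, H x ⊆ Metric.ball x δ) (hHm : ∀ x, MeasurableSet (H x))
    (hq : IsDrift C q)
    (hbq : ∀ᵐ x ∂volume.restrict Ω, ∀ y, q (x, y) = (H x).indicator (fun y => η⁻¹ * ⟪b x, y - x⟫) y)
    (u v : energySpace γ δ Ω) :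
    ∫ x in Ω, ⟪b x, nonlocalGradient γ η δ H u.1 x⟫ * v.1 x =
      ∫ p, increment (cutKernel γ δ) (zeroExt Ω u.1) p *
        (driftWeight (cutKernel γ δ) q p * zeroExt Ω v.1 p.1)
        ∂(volume.prod volume : Measure (Space d × Space d)) := by
  have hk := isSingularKernel_cutKernel hd γ hδ
  have hu := isAdmissible_zeroExt hd γ hδ hΩ u
  have hv := isAdmissible_zeroExt hd γ hδ hΩ v
  have hmain := (ae_restrict_iff' hΩ.measurableSet).1
    (inner_nonlocalGradient hd γ hδ hΩ hH hHm hbq u)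
  simp_rw [increment_mul_driftWeight hk.nonneg]
  rw [integral_prod (fun p => _ * _) (hq.integrable hk hu.increment_memLp hv.memLp),
    ← integral_indicator hΩ.measurableSet]
  refine integral_congr_ae ?_
  filter_upwards [hmain] with x hx
  have hpull : ∫ y, cutKernel γ δ (y - x) * q (x, y) *
      ((zeroExt Ω u.1 y - zeroExt Ω u.1 x) * zeroExt Ω v.1 x) =
      (∫ y, cutKernel γ δ (y - x) * q (x, y) * (zeroExt Ω u.1 y - zeroExt Ω u.1 x)) *
        zeroExt Ω v.1 x := by
    rw [← integral_mul_const]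
    simp_rw [mul_assoc]
  rw [hpull]
  by_cases hxΩ : x ∈ Ω
  · rw [indicator_of_mem hxΩ, hx hxΩ, zeroExt, zeroExt, indicator_of_mem hxΩ, indicator_of_mem hxΩ]
  · rw [indicator_of_notMem hxΩ, hv.zero_off x hxΩ, mul_zero]

/-- The form of the convection-diffusion problem with drift coefficient `q`. -/
noncomputable def driftForm (ε : ℝ) {C : ℝ} {q : Space d × Space d → ℝ} (hq : IsDrift C q) :
    energySpace γ δ Ω →ₗ[ℝ] energySpace γ δ Ω →ₗ[ℝ] ℝ :=
  (innerₗ (Lp ℝ 2 (volume.prod volume : Measure (Space d × Space d)))).compl₁₂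
    (energyMap hd γ hδ hΩ)
    (ε • energyMap hd γ hδ hΩ +
      weightMap (driftWeight (cutKernel γ δ) q)
        (fun _ hF => (hq.weight (isSingularKernel_cutKernel hd γ hδ) hF).1) ∘ₗ
          extensionMap hd γ hδ hΩ)

theorem driftForm_apply (ε : ℝ) {C : ℝ} {q : Space d × Space d → ℝ} (hq : IsDrift C q)
    (u v : energySpace γ δ Ω) :
    driftForm hd γ hδ hΩ ε hq u v =
      ε * (∫ p, increment (cutKernel γ δ) (zeroExt Ω u.1) p *
        increment (cutKernel γ δ) (zeroExt Ω v.1) p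
        ∂(volume.prod volume : Measure (Space d × Space d))) +
      ∫ p, increment (cutKernel γ δ) (zeroExt Ω u.1) p *
        (driftWeight (cutKernel γ δ) q p * zeroExt Ω v.1 p.1)
        ∂(volume.prod volume : Measure (Space d × Space d)) := by
  have hk := isSingularKernel_cutKernel hd γ hδ
  have hu := isAdmissible_zeroExt hd γ hδ hΩ u
  have hv := isAdmissible_zeroExt hd γ hδ hΩ v
  have hw : weightMap (driftWeight (cutKernel γ δ) q) (fun _ hF => (hq.weight hk hF).1)
      (extensionMap hd γ hδ hΩ v) = ((hq.weight hk hv.memLp).1).toLp _ := by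
    change MemLp.toLp _ (hq.weight hk (Lp.memLp (extensionMap hd γ hδ hΩ v))).1 = _
    rw [MemLp.toLp_eq_toLp_iff]
    filter_upwards [(Measure.quasiMeasurePreserving_fst (μ := volume) (ν := volume)).ae
      (extensionMap_ae hd γ hδ hΩ v)] with p hp
    rw [hp]
  simp only [driftForm, LinearMap.compl₁₂_apply, LinearMap.add_apply, LinearMap.smul_apply,
    LinearMap.comp_apply, innerₗ_apply_apply, inner_add_right, real_inner_smul_right]
  rw [hw]
  congr 2
  · exact inner_toLp hu.increment_memLp hv.increment_memLp
  · exact inner_toLp hu.increment_memLp (hq.weight hk hv.memLp).1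

theorem convDiffForm_eq_driftForm (ε : ℝ) {η C : ℝ} {b : Space d → Space d}
    {H : Space d → Set (Space d)}
    {q : Space d × Space d → ℝ} (hH : ∀ x, H x ⊆ Metric.ball x δ) (hHm : ∀ x, MeasurableSet (H x))
    (hq : IsDrift C q)
    (hbq : ∀ᵐ x ∂volume.restrict Ω, ∀ y, q (x, y) = (H x).indicator (fun y => η⁻¹ * ⟪b x, y - x⟫) y)
    (u v : energySpace γ δ Ω) :
    convDiffForm γ δ Ω b H η ε u v = driftForm hd γ hδ hΩ ε hq u v := by
  rw [driftForm_apply, convDiffForm, convection_eq_integral hd γ hδ hΩ hH hHm hq hbq,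
    ← inner_energyMap hd γ hδ hΩ]
  congr 2
  exact inner_toLp (isAdmissible_zeroExt hd γ hδ hΩ u).increment_memLp
    (isAdmissible_zeroExt hd γ hδ hΩ v).increment_memLp

/-- The weighted test function has norm at most √S ‖v‖ in L², where S = C² ∫ k(z)|z|² dz, and
Poincaré bounds ‖v‖ by the energy norm. -/
theorem exists_driftForm_bound (hΩb : Bornology.IsBounded Ω) (ε : ℝ) {C : ℝ}
    {q : Space d × Space d → ℝ} (hq : IsDrift C q) :
    ∃ D, ∀ u v : energySpace γ δ Ω, |driftForm hd γ hδ hΩ ε hq u v| ≤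
      D * ‖energyMap hd γ hδ hΩ u‖ * ‖energyMap hd γ hδ hΩ v‖ := by
  have hk := isSingularKernel_cutKernel hd γ hδ
  obtain ⟨P, hP, hle⟩ := exists_norm_extensionMap_le hd γ hδ hΩ hΩb
  set S := ∫ z, C ^ 2 * (cutKernel γ δ z * ‖z‖ ^ 2)
  have hS0 : 0 ≤ S := integral_nonneg fun z =>
    mul_nonneg (sq_nonneg _) (mul_nonneg (hk.nonneg _) (sq_nonneg _))
  have hw : ∀ F, ‖weightMap (driftWeight (cutKernel γ δ) q) (fun _ hF => (hq.weight hk hF).1) F‖ ≤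
      √S * ‖F‖ := fun F => by
    refine (sq_le_sq₀ (norm_nonneg _) (by positivity)).1 ?_
    rw [mul_pow, Real.sq_sqrt hS0]
    refine ((norm_toLp_sq (hq.weight hk (Lp.memLp F)).1).trans_le (hq.weight hk (Lp.memLp F)).2).trans_eq ?_
    rw [← norm_toLp_sq (Lp.memLp F), Lp.toLp_coeFn]
  refine ⟨|ε| + √S * P, fun u v => ?_⟩
  simp only [driftForm, LinearMap.compl₁₂_apply, innerₗ_apply_apply]
  refine (abs_real_inner_le_norm _ _).trans ?_
  rw [mul_comm (_ + _) ‖_‖, mul_assoc]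
  refine mul_le_mul_of_nonneg_left ?_ (norm_nonneg _)
  rw [LinearMap.add_apply, LinearMap.smul_apply, LinearMap.comp_apply, add_mul]
  refine (norm_add_le _ _).trans (add_le_add (by rw [norm_smul, Real.norm_eq_abs])
    ((hw _).trans ?_))
  rw [mul_assoc]
  exact mul_le_mul_of_nonneg_left (hle v) (Real.sqrt_nonneg _)

end Convection

/-! ### Skewness of odd drifts -/

/-- A drift whose coefficient is an odd function of the difference is skew. -/
theorem integral_odd_drift_eq_zero {k : Space d → ℝ} (hk : IsSingularKernel k) {C : ℝ}
    {q : Space d → ℝ} (hqm : Measurable q)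
    (hq : IsDrift C fun p : Space d × Space d => q (p.2 - p.1))
    (hodd : ∀ z, q (-z) = -q z) {Ω : Set (Space d)} {f : Space d → ℝ} (hf : IsAdmissible k Ω f) :
    ∫ p, increment k f p * (driftWeight k (fun p => q (p.2 - p.1)) p * f p.1)
      ∂(volume.prod volume : Measure (Space d × Space d)) = 0 := by
  simp_rw [increment_mul_driftWeight hk.nonneg]
  set Φ : Space d × Space d → ℝ := fun p =>
    k (p.2 - p.1) * q (p.2 - p.1) * ((f p.2 - f p.1) * f p.1)
  have hΦi : Integrable Φ (volume.prod volume) := hq.integrable hk hf.increment_memLp hf.memLp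
  have hswap : ∫ p, Φ p.swap ∂(volume.prod volume : Measure (Space d × Space d)) =
      ∫ p, Φ p ∂(volume.prod volume) := integral_prod_swap Φ
  -- Adding the integrand to its copy with x and y exchanged gives k q (f(y)² - f(x)²), since k is
  -- even and q odd. For fixed y - x its integral over x is zero by translation invariance. Only the
  -- whole sum is known to be integrable, so Fubini is applied to Θ and not to its two terms.
  let Θ : Space d × Space d → ℝ := fun p => k p.2 * q p.2 * (f (p.1 + p.2) ^ 2 - f p.1 ^ 2)
  have hΘm : Measurable Θ :=
    ((hk.measurable.comp measurable_snd).mul (hqm.comp measurable_snd)).mul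
      (((hf.measurable.comp (measurable_fst.add measurable_snd)).pow_const 2).sub
        ((hf.measurable.comp measurable_fst).pow_const 2))
  have hsum : ∀ p : Space d × Space d, Φ p + Φ p.swap = Θ (p.1, p.2 - p.1) := fun p => by
    have h1 : p.1 - p.2 = -(p.2 - p.1) := (neg_sub _ _).symm
    simp only [Φ, Θ, Prod.fst_swap, Prod.snd_swap, h1, hk.even, hodd, add_sub_cancel]
    ring
  have hΘi : Integrable Θ (volume.prod volume) := by
    refine (measurePreserving_sub_left.integrable_comp hΘm.aestronglyMeasurable).1 ?_
    exact (hΦi.add hΦi.swap).congr (ae_of_all _ hsum)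
  have hΘ0 : ∫ p, Θ p ∂(volume.prod volume : Measure (Space d × Space d)) = 0 := by
    rw [integral_prod_symm _ hΘi]
    refine integral_eq_zero_of_ae (ae_of_all _ fun z => ?_)
    have hsq : Integrable fun x => f x ^ 2 :=
      (memLp_two_iff_integrable_sq hf.memLp.1).1 hf.memLp
    simp only [Θ]
    rw [integral_const_mul, integral_sub (hsq.comp_add_right z) hsq,
      integral_add_right_eq_self (fun x => f x ^ 2) z, sub_self, mul_zero]
    rfl
  have h2 : ∫ p, (Φ p + Φ p.swap) ∂(volume.prod volume : Measure (Space d × Space d)) = 0 := by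
    simp_rw [hsum]
    rw [integral_comp_sub_left hΘm.aestronglyMeasurable, hΘ0]
  have hΦs : Integrable (fun p : Space d × Space d => Φ p.swap) (volume.prod volume) := hΦi.swap
  have h3 := integral_add hΦi hΦs
  rw [hswap] at h3
  linarith

/-! ### Near and far parts; coercivity up to finite rank -/

/-- The part of a drift coefficient acting at distances less than `r`. -/
noncomputable def nearPart (r : ℝ) (q : Space d × Space d → ℝ) : Space d × Space d → ℝ :=
  {p | ‖p.2 - p.1‖ < r}.indicator q

/-- The part of a drift coefficient acting at distances at least `r`. -/
noncomputable def farPart (r : ℝ) (q : Space d × Space d → ℝ) : Space d × Space d → ℝ :=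
  {p | ‖p.2 - p.1‖ < r}ᶜ.indicator q

theorem measurableSet_near (r : ℝ) :
    MeasurableSet {p : Space d × Space d | ‖p.2 - p.1‖ < r} :=
  (isOpen_lt (continuous_snd.sub continuous_fst).norm continuous_const).measurableSet

theorem IsDrift.indicator {C : ℝ} {q : Space d × Space d → ℝ} (hq : IsDrift C q)
    {s : Set (Space d × Space d)} (hs : MeasurableSet s) : IsDrift C (s.indicator q) where
  measurable := hq.measurable.indicator hs
  bound p := by
    by_cases hp : p ∈ s
    · rw [indicator_of_mem hp]
      exact hq.bound p
    · rw [indicator_of_notMem hp, abs_zero]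
      exact (abs_nonneg _).trans (hq.bound p)

theorem IsDrift.nearPart {C : ℝ} {q : Space d × Space d → ℝ} (hq : IsDrift C q) (r : ℝ) :
    IsDrift C (nearPart r q) := hq.indicator (measurableSet_near r)

theorem IsDrift.farPart {C : ℝ} {q : Space d × Space d → ℝ} (hq : IsDrift C q) (r : ℝ) :
    IsDrift C (farPart r q) := hq.indicator (measurableSet_near r).compl

/-- The balls shrink to {0}, where F vanishes, so the integrals tend to zero. -/
theorem exists_setIntegral_ball_lt {F : Space d → ℝ} (hF : Integrable F) (hF0 : F 0 = 0) {τ : ℝ}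
    (hτ : 0 < τ) : ∃ r > 0, ∫ z in Metric.ball 0 r, F z < τ := by
  have hanti : Antitone fun n : ℕ => Metric.ball (0 : Space d) (1 / ((n : ℝ) + 1)) :=
    fun m n hmn => Metric.ball_subset_ball (Nat.one_div_le_one_div hmn)
  have hlim := tendsto_setIntegral_of_antitone (f := F) (μ := volume)
    (fun n : ℕ => (Metric.isOpen_ball (x := (0 : Space d)) (ε := 1 / ((n : ℝ) + 1))).measurableSet)
    hanti ⟨0, hF.integrableOn⟩
  have hInter : ⋂ n : ℕ, Metric.ball (0 : Space d) (1 / ((n : ℝ) + 1)) = {0} := by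
    refine Subset.antisymm (fun z hz => ?_) (fun z hz => ?_)
    · have h : ∀ n : ℕ, ‖z‖ ≤ 1 / ((n : ℝ) + 1) := fun n => by
        have := mem_iInter.1 hz n
        rw [mem_ball_zero_iff] at this
        exact this.le
      have := ge_of_tendsto' tendsto_one_div_add_atTop_nhds_zero_nat h
      exact norm_le_zero_iff.1 this
    · rw [mem_singleton_iff.1 hz]
      exact mem_iInter.2 fun n => Metric.mem_ball_self Nat.one_div_pos_of_nat
  rw [hInter, setIntegral_eq_zero_of_forall_eq_zero (fun z hz => by
    rw [mem_singleton_iff.1 hz, hF0])] at hlim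
  obtain ⟨n, hn⟩ := (hlim.eventually_lt_const hτ).exists
  exact ⟨_, Nat.one_div_pos_of_nat, hn⟩

/-- Only the second moment of k over the ball of radius r enters the bound, and it tends to zero
with r. -/
theorem exists_nearPart_small (hd : 0 < d) {k : Space d → ℝ} (hk : IsSingularKernel k)
    {Ω : Set (Space d)} (hΩ : Bornology.IsBounded Ω) {C : ℝ} {q : Space d × Space d → ℝ}
    (hq : IsDrift C q) {θ : ℝ} (hθ : 0 < θ) :
    ∃ r > 0, ∀ f, IsAdmissible k Ω f →
      |∫ p, increment k f p * (driftWeight k (nearPart r q) p * f p.1)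
        ∂(volume.prod volume : Measure (Space d × Space d))| ≤
        θ * ∫ p, increment k f p ^ 2 ∂(volume.prod volume : Measure (Space d × Space d)) := by
  obtain ⟨P, hP, hle⟩ := exists_poincare hd hk hΩ
  -- The threshold θ² / P cancels the Poincaré constant P, leaving θ² times the energy under a
  -- square root.
  obtain ⟨r, hr, hrlt⟩ := exists_setIntegral_ball_lt (hk.moment.const_mul (C ^ 2)) (by simp)
    (show 0 < θ ^ 2 / P by positivity)
  refine ⟨r, hr, fun f hf => ?_⟩
  have hn := hq.nearPart r
  have hw : Integrable ((Metric.ball (0 : Space d) r).indicator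
      fun z => C ^ 2 * (k z * ‖z‖ ^ 2)) :=
    (hk.moment.const_mul (C ^ 2)).indicator Metric.isOpen_ball.measurableSet
  have hdom : ∀ p : Space d × Space d, driftWeight k (nearPart r q) p ^ 2 ≤
      (Metric.ball (0 : Space d) r).indicator (fun z => C ^ 2 * (k z * ‖z‖ ^ 2)) (p.2 - p.1) :=
    fun p => by
      by_cases hp : ‖p.2 - p.1‖ < r
      · rw [indicator_of_mem (by simpa using hp)]
        exact driftWeight_sq_le hk.nonneg (hn.bound p)
      · rw [indicator_of_notMem (by simpa using hp), driftWeight, nearPart,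
          indicator_of_notMem (show p ∉ {p : Space d × Space d | ‖p.2 - p.1‖ < r} from hp), mul_zero, zero_pow two_ne_zero]
  obtain ⟨h1, h2⟩ := memLp_weight_mul (measurable_driftWeight hk.measurable hn.measurable) hw hdom
    hf.memLp
  set I := ∫ p, increment k f p ^ 2 ∂(volume.prod volume : Measure (Space d × Space d))
  have hI0 : 0 ≤ I := integral_nonneg fun p => sq_nonneg _
  refine (abs_integral_mul_le hf.increment_memLp h1).trans ?_
  have h3 : ∫ p, (driftWeight k (nearPart r q) p * f p.1) ^ 2
      ∂(volume.prod volume : Measure (Space d × Space d)) ≤ θ ^ 2 * I := by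
    refine h2.trans ?_
    rw [integral_indicator Metric.isOpen_ball.measurableSet]
    calc _ ≤ θ ^ 2 / P * (P * I) :=
          mul_le_mul hrlt.le (hle f hf.measurable hf.zero_off hf.memLp hf.increment_memLp)
            (integral_nonneg fun x => sq_nonneg _) (by positivity)
      _ = _ := by field_simp
  calc √I * √(∫ p, (driftWeight k (nearPart r q) p * f p.1) ^ 2 ∂_) ≤ √I * √(θ ^ 2 * I) := by
        gcongr
    _ = θ * I := by
        rw [Real.sqrt_mul (sq_nonneg _), Real.sqrt_sq hθ.le, mul_left_comm, Real.mul_self_sqrt hI0]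

theorem exists_farPart_bound {k : Space d → ℝ} (hk : IsSingularKernel k) {C : ℝ}
    {q : Space d × Space d → ℝ} (hq : IsDrift C q) {r : ℝ} (hr : 0 < r) :
    ∃ K, 0 ≤ K ∧ ∀ p : Space d × Space d, |k (p.2 - p.1) * farPart r q p| ≤ K := by
  obtain ⟨K, hK⟩ := hk.bounded_away r hr
  refine ⟨|C| * |K|, by positivity, fun p => ?_⟩
  by_cases hp : ‖p.2 - p.1‖ < r
  · rw [farPart, indicator_of_notMem (by simpa using hp), mul_zero, abs_zero]
    positivity
  · rw [farPart, indicator_of_mem hp, abs_mul, abs_of_nonneg (hk.nonneg _)]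
    calc k (p.2 - p.1) * |q p| ≤ k (p.2 - p.1) * (|C| * ‖p.2 - p.1‖) := by
          refine mul_le_mul_of_nonneg_left ((hq.bound p).trans ?_) (hk.nonneg _)
          exact mul_le_mul_of_nonneg_right (le_abs_self C) (norm_nonneg _)
      _ = |C| * (k (p.2 - p.1) * ‖p.2 - p.1‖) := by ring
      _ ≤ |C| * |K| := by
          refine mul_le_mul_of_nonneg_left ((hK _ (not_lt.1 hp)).trans (le_abs_self K))
            (abs_nonneg _)

theorem integral_drift_split {k : Space d → ℝ} (hk : IsSingularKernel k) {C : ℝ}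
    {q : Space d × Space d → ℝ} (hq : IsDrift C q) (r : ℝ) {f g : Space d → ℝ}
    (hf : MemLp (increment k f) 2 (volume.prod volume)) (hg : MemLp g 2 volume) :
    ∫ p, increment k f p * (driftWeight k q p * g p.1)
        ∂(volume.prod volume : Measure (Space d × Space d)) =
      ∫ p, increment k f p * (driftWeight k (nearPart r q) p * g p.1)
        ∂(volume.prod volume : Measure (Space d × Space d)) +
      ∫ p, k (p.2 - p.1) * farPart r q p * ((f p.2 - f p.1) * g p.1)
        ∂(volume.prod volume : Measure (Space d × Space d)) := by
  simp_rw [increment_mul_driftWeight hk.nonneg]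
  rw [← integral_add ((hq.nearPart r).integrable hk hf hg)
    ((hq.farPart r).integrable hk hf hg)]
  refine integral_congr_ae (ae_of_all _ fun p => ?_)
  have : nearPart r q p + farPart r q p = q p := congrFun (indicator_self_add_compl _ q) p
  simp only
  rw [← this]
  simp only [nearPart, farPart]
  ring

theorem IsAdmissible.integrable {k : Space d → ℝ} {Ω : Set (Space d)} {f : Space d → ℝ}
    (hf : IsAdmissible k Ω f) (hΩ : Bornology.IsBounded Ω) : Integrable f := by
  have : IsFiniteMeasure (volume.restrict Ω) := ⟨by
    rw [Measure.restrict_apply_univ]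
    exact hΩ.measure_lt_top⟩
  have h : IntegrableOn f Ω := (hf.memLp.restrict Ω).integrable one_le_two
  refine (integrableOn_iff_integrable_of_support_subset fun x hx => ?_).1 h
  by_contra hxΩ
  exact hx (hf.zero_off x hxΩ)

theorem integrable_bounded_mul_tensor {h : Space d × Space d → ℝ} (hm : Measurable h) {K : ℝ}
    (hK : ∀ p, |h p| ≤ K) {f g : Space d → ℝ} (hf : Integrable f) (hg : Integrable g) :
    Integrable (fun p : Space d × Space d => h p * (f p.1 * g p.2)) (volume.prod volume) :=
  (hf.mul_prod hg).bdd_mul hm.aestronglyMeasurable (ae_of_all _ hK)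

/-- The far part of a non-positive drift is bounded below by its off-diagonal part. -/
theorem integral_far_ge {k : Space d → ℝ} (hk : IsSingularKernel k) {C : ℝ}
    {q : Space d × Space d → ℝ} (hq : IsDrift C q) (hq0 : ∀ p, q p ≤ 0) {r : ℝ} {K : ℝ}
    (hK : ∀ p : Space d × Space d, |k (p.2 - p.1) * farPart r q p| ≤ K) {Ω : Set (Space d)}
    (hΩ : Bornology.IsBounded Ω) {f : Space d → ℝ} (hf : IsAdmissible k Ω f) :
    ∫ p, k (p.2 - p.1) * farPart r q p * (f p.1 * f p.2)
        ∂(volume.prod volume : Measure (Space d × Space d)) ≤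
      ∫ p, k (p.2 - p.1) * farPart r q p * ((f p.2 - f p.1) * f p.1)
        ∂(volume.prod volume : Measure (Space d × Space d)) := by
  have hfar := hq.farPart r
  have hm : Measurable fun p : Space d × Space d => k (p.2 - p.1) * farPart r q p :=
    (hk.measurable.comp (measurable_snd.sub measurable_fst)).mul hfar.measurable
  refine integral_mono (integrable_bounded_mul_tensor hm hK (hf.integrable hΩ) (hf.integrable hΩ))
    (hfar.integrable hk hf.increment_memLp hf.memLp) fun p => ?_
  have h0 : k (p.2 - p.1) * farPart r q p ≤ 0 :=
    mul_nonpos_of_nonneg_of_nonpos (hk.nonneg _) (indicator_nonpos (fun p _ => hq0 p) p)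
  simp only
  nlinarith [mul_nonneg (neg_nonneg.2 h0) (sq_nonneg (f p.1))]

/-- A bounded kernel on a bounded set is a finite rank form up to a small error. -/
theorem exists_finiteRank_approx {Ω : Set (Space d)} (hΩ : Bornology.IsBounded Ω)
    {h : Space d × Space d → ℝ} (hm : Measurable h) {K : ℝ} (hK : ∀ p, |h p| ≤ K) {θ : ℝ}
    (hθ : 0 < θ) :
    ∃ (n : ℕ) (a b : Fin n → Space d → ℝ), (∀ i, MemLp (a i) 2 (volume.restrict Ω)) ∧
      (∀ i, MemLp (b i) 2 (volume.restrict Ω)) ∧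
      ∀ f : Space d → ℝ, MemLp f 2 volume → (∀ x ∉ Ω, f x = 0) →
        |∫ p, h p * (f p.1 * f p.2) ∂(volume.prod volume : Measure (Space d × Space d)) -
          ∑ i, (∫ x in Ω, b i x * f x) * ∫ x in Ω, a i x * f x| ≤ θ * ∫ x, f x ^ 2 := by
  have hfin : IsFiniteMeasure (volume.restrict Ω) := ⟨by
    rw [Measure.restrict_apply_univ]
    exact hΩ.measure_lt_top⟩
  have hmem : MemLp h 2 ((volume.restrict Ω).prod (volume.restrict Ω)) :=
    MemLp.of_bound hm.aestronglyMeasurable K (ae_of_all _ hK)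
  obtain ⟨n, a, b, ha, hb, hab⟩ := exists_sum_tensor_close hmem hθ
  refine ⟨n, a, b, ha, hb, fun f hf hf0 => ?_⟩
  have hfΩ : MemLp f 2 (volume.restrict Ω) := hf.restrict Ω
  have hff := memLp_tensor hfΩ hfΩ
  have hrestr : ∫ p, h p * (f p.1 * f p.2) ∂(volume.prod volume : Measure (Space d × Space d)) =
      ∫ p, h p * (f p.1 * f p.2) ∂(volume.restrict Ω).prod (volume.restrict Ω) := by
    rw [Measure.prod_restrict]
    refine (setIntegral_eq_integral_of_forall_compl_eq_zero fun p hp => ?_).symm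
    rw [mem_prod, not_and_or] at hp
    rcases hp with hp | hp <;> simp [hf0 _ hp]
  have hterm : ∀ i, MemLp (fun p : Space d × Space d => a i p.1 * b i p.2) 2
      ((volume.restrict Ω).prod (volume.restrict Ω)) := fun i => memLp_tensor (ha i) (hb i)
  have htermi : ∀ i, Integrable (fun p : Space d × Space d =>
      a i p.1 * b i p.2 * (f p.1 * f p.2)) ((volume.restrict Ω).prod (volume.restrict Ω)) :=
    fun i => (hterm i).integrable_mul hff
  have hsum : ∑ i, (∫ x in Ω, b i x * f x) * ∫ x in Ω, a i x * f x =
      ∫ p, (∑ i, a i p.1 * b i p.2) * (f p.1 * f p.2)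
        ∂(volume.restrict Ω).prod (volume.restrict Ω) := by
    simp_rw [Finset.sum_mul]
    rw [integral_finsetSum _ fun i _ => htermi i]
    refine Finset.sum_congr rfl fun i _ => ?_
    rw [mul_comm, ← integral_prod_mul]
    refine integral_congr_ae (ae_of_all _ fun p => ?_)
    simp only
    ring
  have hsumL : MemLp (fun p : Space d × Space d => ∑ i, a i p.1 * b i p.2) 2
      ((volume.restrict Ω).prod (volume.restrict Ω)) := memLp_finsetSum _ fun i _ => hterm i
  have hi1 : Integrable (fun p : Space d × Space d => h p * (f p.1 * f p.2))
      ((volume.restrict Ω).prod (volume.restrict Ω)) := hmem.integrable_mul hff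
  have hi2 : Integrable (fun p : Space d × Space d => (∑ i, a i p.1 * b i p.2) * (f p.1 * f p.2))
      ((volume.restrict Ω).prod (volume.restrict Ω)) := hsumL.integrable_mul hff
  have hd2 : MemLp (fun p : Space d × Space d => h p - ∑ i, a i p.1 * b i p.2) 2
      ((volume.restrict Ω).prod (volume.restrict Ω)) := hmem.sub hsumL
  rw [hrestr, hsum, ← integral_sub hi1 hi2]
  simp_rw [← sub_mul]
  -- Cauchy–Schwarz on the product: the L² norm of f(x) f(y) is exactly ∫ f², so the kernel error θ
  -- passes to the form.
  refine (abs_integral_mul_le hd2 hff).trans ?_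
  have hE : ∫ x in Ω, f x ^ 2 = ∫ x, f x ^ 2 :=
    setIntegral_eq_integral_of_forall_compl_eq_zero fun x hx => by
      rw [hf0 x hx, zero_pow two_ne_zero]
  rw [integral_tensor_sq, hE, Real.sqrt_mul_self (integral_nonneg fun x => sq_nonneg _)]
  exact mul_le_mul_of_nonneg_right (Real.sqrt_le_iff.2 ⟨hθ.le, hab⟩)
    (integral_nonneg fun x => sq_nonneg _)

section UpwindForm

variable (hd : 0 < d) (γ : DiffusionKernel d) {δ : ℝ} (hδ : 0 < δ) {Ω : Set (Space d)}
  (hΩ : IsOpen Ω)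

theorem norm_energyMap_sq (u : energySpace γ δ Ω) :
    ‖energyMap hd γ hδ hΩ u‖ ^ 2 = ∫ p, increment (cutKernel γ δ) (zeroExt Ω u.1) p ^ 2
      ∂(volume.prod volume : Measure (Space d × Space d)) :=
  norm_toLp_sq (isAdmissible_zeroExt hd γ hδ hΩ u).increment_memLp

/-- The pairing with a square integrable function on `Ω` is a bounded functional. -/
theorem exists_pairing (hΩb : Bornology.IsBounded Ω) {a : Space d → ℝ}
    (ha : MemLp a 2 (volume.restrict Ω)) :
    ∃ φ : energySpace γ δ Ω →ₗ[ℝ] ℝ, (∀ u, φ u = ∫ x in Ω, a x * zeroExt Ω u.1 x) ∧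
      ∃ D, ∀ u, |φ u| ≤ D * ‖energyMap hd γ hδ hΩ u‖ := by
  have ha' : MemLp (Ω.indicator a) 2 volume := (memLp_indicator_iff_restrict hΩ.measurableSet).2 ha
  obtain ⟨P, hP, hle⟩ := exists_norm_extensionMap_le hd γ hδ hΩ hΩb
  refine ⟨innerₗ _ (ha'.toLp _) ∘ₗ extensionMap hd γ hδ hΩ, fun u => ?_,
    ‖ha'.toLp _‖ * P, fun u => ?_⟩
  · rw [LinearMap.comp_apply, innerₗ_apply_apply, ← integral_indicator hΩ.measurableSet]
    refine (inner_toLp ha' (isAdmissible_zeroExt hd γ hδ hΩ u).memLp).trans ?_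
    refine integral_congr_ae (ae_of_all _ fun x => ?_)
    by_cases hx : x ∈ Ω <;> simp [hx]
  · rw [LinearMap.comp_apply, innerₗ_apply_apply, mul_assoc]
    exact (abs_real_inner_le_norm _ _).trans
      (mul_le_mul_of_nonneg_left (hle u) (norm_nonneg _))

set_option maxHeartbeats 600000 in
/-- A non-positive drift is coercive up to a form of finite rank. -/
theorem exists_finiteRank_coercive (hΩb : Bornology.IsBounded Ω) {ε : ℝ} (hε : 0 < ε) {C : ℝ}
    {q : Space d × Space d → ℝ} (hq : IsDrift C q) (hq0 : ∀ p, q p ≤ 0) :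
    ∃ (n : ℕ) (φ ψ : Fin n → energySpace γ δ Ω →ₗ[ℝ] ℝ),
      (∀ i, ∃ D, ∀ u, |φ i u| ≤ D * ‖energyMap hd γ hδ hΩ u‖) ∧
      (∀ i, ∃ D, ∀ u, |ψ i u| ≤ D * ‖energyMap hd γ hδ hΩ u‖) ∧
      ∀ u, ε / 2 * ‖energyMap hd γ hδ hΩ u‖ ^ 2 ≤
        driftForm hd γ hδ hΩ ε hq u u - ∑ i, φ i u * ψ i u := by
  have hk := isSingularKernel_cutKernel hd γ hδ
  -- The near part costs ε / 4 of the energy and, by Poincaré, the finite rank error ε / (4P) ∫ f²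
  -- another ε / 4; ε / 2 is left.
  obtain ⟨r, hr, hnear⟩ := exists_nearPart_small hd hk hΩb hq (by positivity : 0 < ε / 4)
  obtain ⟨K, -, hK⟩ := exists_farPart_bound hk hq hr
  obtain ⟨P, hP, hle⟩ := exists_poincare hd hk hΩb
  have hm : Measurable fun p : Space d × Space d => cutKernel γ δ (p.2 - p.1) * farPart r q p :=
    (hk.measurable.comp (measurable_snd.sub measurable_fst)).mul (hq.farPart r).measurable
  obtain ⟨n, a, b, ha, hb, hab⟩ :=
    exists_finiteRank_approx hΩb hm hK (by positivity : 0 < ε / (4 * P))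
  choose ψ hψ hψb using fun i => exists_pairing hd γ hδ hΩ hΩb (ha i)
  choose φ hφ hφb using fun i => exists_pairing hd γ hδ hΩ hΩb (hb i)
  refine ⟨n, φ, ψ, hφb, hψb, fun u => ?_⟩
  have hu := isAdmissible_zeroExt hd γ hδ hΩ u
  have h1 := (abs_le.1 (hnear _ hu)).1
  have h2 := integral_far_ge hk hq hq0 hK hΩb hu
  have h3 := (abs_le.1 (hab _ hu.memLp hu.zero_off)).1
  have h4 := mul_le_mul_of_nonneg_left
    (hle _ hu.measurable hu.zero_off hu.memLp hu.increment_memLp)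
    (by positivity : 0 ≤ ε / (4 * P))
  rw [driftForm_apply, integral_drift_split hk hq r hu.increment_memLp hu.memLp]
  simp_rw [hφ, hψ, norm_energyMap_sq, ← pow_two]
  have h5 : ε / (4 * P) * P = ε / 4 := by field_simp
  rw [← mul_assoc, h5] at h4
  linarith

end UpwindForm

/-! ### Truncation and the weak maximum principle -/

/-- Excess of a function over a level. -/
noncomputable def excess (c : ℝ) (f : Space d → ℝ) (x : Space d) : ℝ := max (f x - c) 0

/-- The map s ↦ (s - c)⁺ is non-decreasing and 1-Lipschitz. -/
theorem sq_excess_sub_le (c s t : ℝ) :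
    (max (s - c) 0 - max (t - c) 0) ^ 2 ≤ (s - t) * (max (s - c) 0 - max (t - c) 0) := by
  rcases le_total (s - c) 0 with h1 | h1 <;> rcases le_total (t - c) 0 with h2 | h2 <;>
    simp only [h1, h2, max_eq_left, max_eq_right] <;> nlinarith

/-- Where t > c the excess of t is t - c, while that of s is at least s - c. Multiplying by a
non-positive drift reverses the inequality, which is where the sign of q enters. -/
theorem sub_mul_excess_le (c s t : ℝ) :
    (s - t) * max (t - c) 0 ≤ (max (s - c) 0 - max (t - c) 0) * max (t - c) 0 := by
  rcases le_total (s - c) 0 with h1 | h1 <;> rcases le_total (t - c) 0 with h2 | h2 <;>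
    simp only [h1, h2, max_eq_left, max_eq_right] <;> nlinarith

/-- Taking c ≥ 0 keeps the excess zero off Ω; the 1-Lipschitz property of truncation keeps the
energy finite. -/
theorem IsAdmissible.excess {k : Space d → ℝ} (hk : IsSingularKernel k) {Ω : Set (Space d)}
    {f : Space d → ℝ} (hf : IsAdmissible k Ω f) {c : ℝ} (hc : 0 ≤ c) :
    IsAdmissible k Ω (excess c f) := by
  have hm : Measurable (NonlocalCD.excess c f) := (hf.measurable.sub_const c).max measurable_const
  refine ⟨hm, fun x hx => ?_, ?_, ?_⟩
  · simp [NonlocalCD.excess, hf.zero_off x hx, hc]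
  · refine hf.memLp.mono hm.aestronglyMeasurable (ae_of_all _ fun x => ?_)
    rw [Real.norm_of_nonneg (show 0 ≤ NonlocalCD.excess c f x from le_max_right _ _)]
    exact max_le ((sub_le_self _ hc).trans (le_abs_self _)) (abs_nonneg _)
  · refine hf.increment_memLp.mono (measurable_increment hk.measurable hm).aestronglyMeasurable
      (ae_of_all _ fun p => ?_)
    rw [increment, increment, norm_mul, norm_mul]
    refine mul_le_mul_of_nonneg_left ?_ (norm_nonneg _)
    refine (abs_max_sub_max_le_abs (f p.2 - c) (f p.1 - c) 0).trans_eq ?_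
    rw [sub_sub_sub_cancel_right, Real.norm_eq_abs]

/-- Testing a non-positive drift with the excess only increases when the function itself is
replaced by its excess. -/
theorem integral_excess_le {k : Space d → ℝ} (hk : IsSingularKernel k) {C : ℝ}
    {q : Space d × Space d → ℝ} (hq : IsDrift C q) (hq0 : ∀ p, q p ≤ 0) {ε : ℝ} (hε : 0 < ε)
    {Ω : Set (Space d)} {f : Space d → ℝ} (hf : IsAdmissible k Ω f) {c : ℝ} (hc : 0 ≤ c) :
    ε * (∫ p, increment k (excess c f) p ^ 2
        ∂(volume.prod volume : Measure (Space d × Space d))) +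
      ∫ p, increment k (excess c f) p * (driftWeight k q p * excess c f p.1)
        ∂(volume.prod volume : Measure (Space d × Space d)) ≤
    ε * (∫ p, increment k f p * increment k (excess c f) p
        ∂(volume.prod volume : Measure (Space d × Space d))) +
      ∫ p, increment k f p * (driftWeight k q p * excess c f p.1)
        ∂(volume.prod volume : Measure (Space d × Space d)) := by
  have hw := hf.excess hk hc
  have hsq : Integrable (fun p => increment k (excess c f) p ^ 2) (volume.prod volume) :=
    (memLp_two_iff_integrable_sq hw.increment_memLp.1).1 hw.increment_memLp
  have hmul : Integrable (fun p => increment k f p * increment k (excess c f) p)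
      (volume.prod volume) := hf.increment_memLp.integrable_mul hw.increment_memLp
  refine add_le_add (mul_le_mul_of_nonneg_left (integral_mono hsq hmul fun p => ?_) hε.le) ?_
  · simp only
    rw [pow_two, increment_mul_increment hk.nonneg, increment_mul_increment hk.nonneg, mul_assoc,
      mul_assoc, ← pow_two]
    exact mul_le_mul_of_nonneg_left (sq_excess_sub_le c _ _) (hk.nonneg _)
  · simp_rw [increment_mul_driftWeight hk.nonneg]
    refine integral_mono (hq.integrable hk hw.increment_memLp hw.memLp)
      (hq.integrable hk hf.increment_memLp hw.memLp) fun p => ?_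
    exact mul_le_mul_of_nonpos_left (sub_mul_excess_le c _ _)
      (mul_nonpos_of_nonneg_of_nonpos (hk.nonneg _) (hq0 p))

theorem abs_integral_indicator_le {Ω s : Set (Space d)} (hΩ : Bornology.IsBounded Ω)
    (hs : MeasurableSet s) (hsΩ : s ⊆ Ω) {w : Space d → ℝ} (hw : MemLp w 2 volume) :
    |∫ x, s.indicator w x| ≤ √(volume.real s) * √(∫ x, w x ^ 2) := by
  have hfin : volume s ≠ ∞ := ne_top_of_le_ne_top hΩ.measure_lt_top.ne (measure_mono hsΩ)
  have h1 : MemLp (s.indicator fun _ => (1 : ℝ)) 2 volume :=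
    memLp_indicator_const 2 hs 1 (Or.inr hfin)
  have h2 := abs_integral_mul_le h1 hw
  have h3 : ∀ x, s.indicator (fun _ => (1 : ℝ)) x * w x = s.indicator w x := fun x => by
    by_cases hx : x ∈ s <;> simp [hx]
  have h4 : ∀ x, s.indicator (fun _ => (1 : ℝ)) x ^ 2 = s.indicator (fun _ => (1 : ℝ)) x :=
    fun x => by by_cases hx : x ∈ s <;> simp [hx]
  simp_rw [h3, h4] at h2
  rwa [integral_indicator_const _ hs, smul_eq_mul, mul_one] at h2

/-- The far part of the drift of an excess is small when the function takes few values strictly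
between the level and its essential supremum. -/
theorem integral_far_excess_ge {k : Space d → ℝ} (hk : IsSingularKernel k) {C : ℝ}
    {q : Space d × Space d → ℝ} (hq : IsDrift C q) (hq0 : ∀ p, q p ≤ 0) {r : ℝ}
    {K : ℝ} (hK0 : 0 ≤ K) (hK : ∀ p : Space d × Space d, |k (p.2 - p.1) * farPart r q p| ≤ K)
    {Ω : Set (Space d)} (hΩo : IsOpen Ω) (hΩ : Bornology.IsBounded Ω) {f : Space d → ℝ}
    (hf : IsAdmissible k Ω f) {c : ℝ} (hc : 0 ≤ c) {s : Set (Space d)} (hs : MeasurableSet s)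
    (hsΩ : s ⊆ Ω) (hgap : ∀ᵐ y : Space d, ∀ x, c < f x → f x < f y → x ∈ s) :
    -(K * √(volume.real Ω) * √(volume.real s) * ∫ x, excess c f x ^ 2) ≤
      ∫ p, k (p.2 - p.1) * farPart r q p * ((excess c f p.2 - excess c f p.1) * excess c f p.1)
        ∂(volume.prod volume : Measure (Space d × Space d)) := by
  have hw := hf.excess hk hc
  set w := excess c f
  have hw0 : ∀ x, 0 ≤ w x := fun x => le_max_right _ _
  have hwi := hw.integrable hΩ
  have hind0 : ∀ x, 0 ≤ s.indicator w x := fun x => indicator_nonneg (fun x _ => hw0 x) x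
  have hT : Integrable (fun p : Space d × Space d => s.indicator w p.1 * w p.2)
      (volume.prod volume) := (hwi.indicator hs).mul_prod hwi
  have hTle : ∫ p : Space d × Space d, s.indicator w p.1 * w p.2 ∂(volume.prod volume) ≤
      √(volume.real Ω) * √(volume.real s) * ∫ x, w x ^ 2 := by
    rw [integral_prod_mul (s.indicator w) w]
    have h1 := (le_abs_self _).trans (abs_integral_indicator_le hΩ hs hsΩ hw.memLp)
    have h2 := (le_abs_self _).trans
      (abs_integral_indicator_le hΩ hΩo.measurableSet subset_rfl hw.memLp)
    have h3 : Ω.indicator w = w := indicator_eq_self.2 fun x hx => by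
      by_contra hxΩ
      exact hx (hw.zero_off x hxΩ)
    rw [h3] at h2
    calc _ ≤ (√(volume.real s) * √(∫ x, w x ^ 2)) * (√(volume.real Ω) * √(∫ x, w x ^ 2)) :=
          mul_le_mul h1 h2 (integral_nonneg hw0) (by positivity)
      _ = √(volume.real Ω) * √(volume.real s) * (√(∫ x, w x ^ 2) * √(∫ x, w x ^ 2)) := by ring
      _ = _ := by rw [Real.mul_self_sqrt (integral_nonneg fun x => sq_nonneg _)]
  have hmono : ∫ p : Space d × Space d, -K * (s.indicator w p.1 * w p.2) ∂(volume.prod volume) ≤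
      ∫ p, k (p.2 - p.1) * farPart r q p * ((w p.2 - w p.1) * w p.1)
        ∂(volume.prod volume : Measure (Space d × Space d)) := by
    refine integral_mono_ae (hT.const_mul _)
      ((hq.farPart r).integrable hk hw.increment_memLp hw.memLp) ?_
    filter_upwards [(Measure.quasiMeasurePreserving_snd (μ := volume) (ν := volume)).ae hgap]
      with p hp
    have hk0 : k (p.2 - p.1) * farPart r q p ≤ 0 :=
      mul_nonpos_of_nonneg_of_nonpos (hk.nonneg _) (indicator_nonpos (fun p _ => hq0 p) p)
    have hkK := (abs_le.1 (hK p)).1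
    have hrhs : 0 ≤ s.indicator w p.1 * w p.2 := mul_nonneg (hind0 _) (hw0 _)
    -- The integrand can be negative only if 0 < w(x) < w(y). Then c < f(x) < f(y), so x lies in s
    -- for almost every y, and (w(y) - w(x)) w(x) ≤ w(x) w(y) gives the lower bound.
    rcases le_or_gt (w p.2) (w p.1) with hle | hlt
    · have h1 : 0 ≤ k (p.2 - p.1) * farPart r q p * ((w p.2 - w p.1) * w p.1) :=
        mul_nonneg_of_nonpos_of_nonpos hk0
          (mul_nonpos_of_nonpos_of_nonneg (sub_nonpos.2 hle) (hw0 _))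
      nlinarith [mul_nonneg hK0 hrhs]
    · rcases (hw0 p.1).eq_or_lt with h0 | h0
      · rw [← h0, mul_zero, mul_zero]
        nlinarith [mul_nonneg hK0 hrhs]
      · have hcf : c < f p.1 := by
          by_contra hcon
          have : w p.1 = 0 := max_eq_right (by linarith)
          linarith
        have hff : f p.1 < f p.2 := by
          by_contra hcon
          have : w p.2 ≤ w p.1 := max_le_max (by linarith) le_rfl
          linarith
        rw [indicator_of_mem (hp _ hcf hff)]
        have h1 : 0 ≤ (w p.2 - w p.1) * w p.1 := mul_nonneg (sub_nonneg.2 hlt.le) h0.le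
        have h2 : (w p.2 - w p.1) * w p.1 ≤ w p.1 * w p.2 := by nlinarith [sq_nonneg (w p.1)]
        nlinarith [mul_le_mul_of_nonneg_right hkK h1, mul_le_mul_of_nonneg_left h2 hK0]
  rw [integral_const_mul] at hmono
  nlinarith [mul_le_mul_of_nonneg_left hTle hK0]

/-- There are levels below the essential supremum with little mass strictly in between. -/
theorem exists_level_small_gap {Ω : Set (Space d)} (hΩ : Bornology.IsBounded Ω)
    {f : Space d → ℝ} (hf : Measurable f) (hf0 : ∀ x ∉ Ω, f x = 0)
    (hpos : ¬∀ᵐ x : Space d, f x ≤ 0) {τ : ℝ} (hτ : 0 < τ) :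
    ∃ (c : ℝ) (s : Set (Space d)), 0 ≤ c ∧ (¬∀ᵐ x : Space d, f x ≤ c) ∧ MeasurableSet s ∧ s ⊆ Ω ∧
      volume.real s < τ ∧ ∀ᵐ y : Space d, ∀ x, c < f x → f x < f y → x ∈ s := by
  -- f need not be bounded above; in `ℝ≥0∞` the essential supremum M always exists and may be ∞. For
  -- levels increasing strictly to M, the sets between level and M decrease to ∅ inside Ω, so their
  -- measure tends to zero.
  set F : Space d → ℝ≥0∞ := fun x => ENNReal.ofReal (f x) with hF
  have hFm : Measurable F := hf.ennreal_ofReal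
  set M := essSup F volume with hM
  have hM0 : 0 < M := by
    rw [pos_iff_ne_zero]
    intro h0
    refine hpos ?_
    filter_upwards [ENNReal.ae_le_essSup F] with x hx
    rw [← hM, h0, nonpos_iff_eq_zero] at hx
    exact ENNReal.ofReal_eq_zero.1 hx
  obtain ⟨c, hc, hcM, hclim⟩ := exists_seq_strictMono_tendsto' hM0
  let s : ℕ → Set (Space d) := fun n => {x | c n < F x ∧ F x < M}
  have hsm : ∀ n, MeasurableSet (s n) := fun n =>
    (measurableSet_lt measurable_const hFm).inter (measurableSet_lt hFm measurable_const)
  have hsΩ : ∀ n, s n ⊆ Ω := fun n x hx => by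
    by_contra hxΩ
    have h1 : c n < F x := hx.1
    simp [F, hf0 x hxΩ] at h1
  have hanti : Antitone s := fun m n hmn x hx => ⟨(hc.monotone hmn).trans_lt hx.1, hx.2⟩
  have hlim := tendsto_measure_iInter_atTop (μ := volume) (fun n => (hsm n).nullMeasurableSet) hanti
    ⟨0, ne_top_of_le_ne_top hΩ.measure_lt_top.ne (measure_mono (hsΩ 0))⟩
  have hempty : ⋂ n, s n = ∅ := by
    refine eq_empty_of_forall_notMem fun x hx => ?_
    rw [mem_iInter] at hx
    obtain ⟨n, hn⟩ := (hclim.eventually_const_lt (hx 0).2).exists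
    exact absurd (hx n).1 (not_lt.2 hn.le)
  rw [hempty, measure_empty] at hlim
  obtain ⟨n, hn⟩ := (hlim.eventually_lt_const (ENNReal.ofReal_pos.2 hτ)).exists
  have hcn : c n ≠ ∞ := (hcM n).2.ne_top
  have hlt : ∀ x, (c n).toReal < f x ↔ c n < F x := fun x => by
    rw [ENNReal.lt_ofReal_iff_toReal_lt hcn]
  refine ⟨(c n).toReal, s n, ENNReal.toReal_nonneg, fun hae => ?_, hsm n, hsΩ n, ?_, ?_⟩
  · have : M ≤ c n := essSup_le_of_ae_le _ (by
      filter_upwards [hae] with x hx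
      exact not_lt.1 fun h => absurd ((hlt x).2 h) (not_lt.2 hx))
    exact absurd (hcM n).2 (not_lt.2 this)
  · rw [measureReal_def]
    exact ENNReal.toReal_lt_of_lt_ofReal hn
  · filter_upwards [ENNReal.ae_le_essSup F] with y hy x hx hxy
    refine ⟨(hlt x).1 hx, lt_of_lt_of_le ?_ hy⟩
    exact (ENNReal.ofReal_lt_ofReal_iff_of_nonneg (ENNReal.toReal_nonneg.trans hx.le)).2 hxy

section MaximumPrinciple

variable (hd : 0 < d) (γ : DiffusionKernel d) {δ : ℝ} (hδ : 0 < δ) {Ω : Set (Space d)}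
  (hΩ : IsOpen Ω)

/-- The weak maximum principle for a non-positive drift. -/
theorem ae_nonpos_of_driftForm_eq_zero (hΩb : Bornology.IsBounded Ω) {ε : ℝ} (hε : 0 < ε) {C : ℝ}
    {q : Space d × Space d → ℝ} (hq : IsDrift C q) (hq0 : ∀ p, q p ≤ 0) {u : energySpace γ δ Ω}
    (hu0 : ∀ v, driftForm hd γ hδ hΩ ε hq u v = 0) : ∀ᵐ x : Space d, zeroExt Ω u.1 x ≤ 0 := by
  by_contra hpos
  have hk := isSingularKernel_cutKernel hd γ hδ
  have hu := isAdmissible_zeroExt hd γ hδ hΩ u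
  obtain ⟨r, hr, hnear⟩ := exists_nearPart_small hd hk hΩb hq (by positivity : 0 < ε / 4)
  obtain ⟨K, hK0, hK⟩ := exists_farPart_bound hk hq hr
  obtain ⟨P, hP, hle⟩ := exists_poincare hd hk hΩb
  set L := K * √(volume.real Ω) * P with hL
  have hL0 : 0 ≤ L := by positivity
  -- Since √|s| ≤ ε / (4 (L + 1)), the far part costs at most ε / 4 of the energy of the excess.
  -- Using L + 1 covers the case L = 0.
  obtain ⟨c, s, hc, hcpos, hsm, hsΩ, hsτ, hgap⟩ := exists_level_small_gap hΩb hu.measurable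
    hu.zero_off hpos (by positivity : 0 < (ε / (4 * (L + 1))) ^ 2)
  have hw := hu.excess hk hc
  obtain ⟨v, hv⟩ := exists_of_isAdmissible hd γ hδ hΩ hw
  have h1 := hu0 v
  rw [driftForm_apply] at h1
  have hvi := increment_congr (k := cutKernel γ δ) hv
  have e1 : ∫ p, increment (cutKernel γ δ) (zeroExt Ω u.1) p *
      increment (cutKernel γ δ) (zeroExt Ω v.1) p
      ∂(volume.prod volume : Measure (Space d × Space d)) =
      ∫ p, increment (cutKernel γ δ) (zeroExt Ω u.1) p *
        increment (cutKernel γ δ) (excess c (zeroExt Ω u.1)) p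
        ∂(volume.prod volume : Measure (Space d × Space d)) := by
    refine integral_congr_ae ?_
    filter_upwards [hvi] with p hp
    rw [hp]
  have e2 : ∫ p, increment (cutKernel γ δ) (zeroExt Ω u.1) p *
      (driftWeight (cutKernel γ δ) q p * zeroExt Ω v.1 p.1)
      ∂(volume.prod volume : Measure (Space d × Space d)) =
      ∫ p, increment (cutKernel γ δ) (zeroExt Ω u.1) p *
        (driftWeight (cutKernel γ δ) q p * excess c (zeroExt Ω u.1) p.1)
        ∂(volume.prod volume : Measure (Space d × Space d)) := by
    refine integral_congr_ae ?_
    filter_upwards [(Measure.quasiMeasurePreserving_fst (μ := volume) (ν := volume)).ae hv]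
      with p hp
    rw [hp]
  rw [e1, e2] at h1
  have h2 := integral_excess_le hk hq hq0 hε hu hc
  rw [h1, integral_drift_split hk hq r hw.increment_memLp hw.memLp] at h2
  have h3 := (abs_le.1 (hnear _ hw)).1
  have h4 := integral_far_excess_ge hk hq hq0 hK0 hK hΩ hΩb hu hc hsm hsΩ hgap
  have h5 := hle _ hw.measurable hw.zero_off hw.memLp hw.increment_memLp
  have hI0 : 0 ≤ ∫ p, increment (cutKernel γ δ) (excess c (zeroExt Ω u.1)) p ^ 2
      ∂(volume.prod volume : Measure (Space d × Space d)) := integral_nonneg fun p => sq_nonneg _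
  have hW0 : 0 ≤ ∫ x, excess c (zeroExt Ω u.1) x ^ 2 := integral_nonneg fun x => sq_nonneg _
  generalize ∫ p, increment (cutKernel γ δ) (excess c (zeroExt Ω u.1)) p ^ 2
    ∂(volume.prod volume : Measure (Space d × Space d)) = I at h2 h3 h5 hI0
  have h6 : √(volume.real s) ≤ ε / (4 * (L + 1)) :=
    Real.sqrt_le_iff.2 ⟨by positivity, hsτ.le⟩
  have h7 : K * √(volume.real Ω) * √(volume.real s) * ∫ x, excess c (zeroExt Ω u.1) x ^ 2 ≤
      ε / 4 * I := by
    calc _ ≤ K * √(volume.real Ω) * (ε / (4 * (L + 1))) * (P * I) := by gcongr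
      _ = ε / 4 * I * (L / (L + 1)) := by rw [hL]; field_simp
      _ ≤ ε / 4 * I := mul_le_of_le_one_right (by positivity)
          ((div_le_one (by positivity)).2 (by linarith))
  -- Near and far parts each cost ε / 4, so ε / 2 times the energy of the excess is at most zero.
  have h8 : I ≤ 0 := by
    have : ε / 2 * I ≤ 0 := by linarith
    by_contra hI
    exact absurd this (not_le.2 (mul_pos (by positivity) (not_le.1 hI)))
  have h9 : ∫ x, excess c (zeroExt Ω u.1) x ^ 2 = 0 :=
    le_antisymm (h5.trans (mul_nonpos_of_nonneg_of_nonpos hP.le h8)) hW0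
  rw [integral_eq_zero_iff_of_nonneg (fun x => sq_nonneg _)
    ((memLp_two_iff_integrable_sq hw.memLp.1).1 hw.memLp)] at h9
  refine hcpos ?_
  filter_upwards [h9] with x hx
  have h10 : excess c (zeroExt Ω u.1) x = 0 := by simpa using hx
  have h11 := le_max_left (zeroExt Ω u.1 x - c) 0
  rw [show max (zeroExt Ω u.1 x - c) 0 = 0 from h10] at h11
  linarith

theorem eq_zero_of_driftForm_eq_zero (hΩb : Bornology.IsBounded Ω) {ε : ℝ} (hε : 0 < ε) {C : ℝ}
    {q : Space d × Space d → ℝ} (hq : IsDrift C q) (hq0 : ∀ p, q p ≤ 0) (u : energySpace γ δ Ω)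
    (hu0 : ∀ v, driftForm hd γ hδ hΩ ε hq u v = 0) : u = 0 := by
  have h1 := ae_nonpos_of_driftForm_eq_zero hd γ hδ hΩ hΩb hε hq hq0 hu0
  have h2 := ae_nonpos_of_driftForm_eq_zero hd γ hδ hΩ hΩb hε hq hq0 (u := -u) fun v => by
    rw [map_neg, LinearMap.neg_apply, hu0, neg_zero]
  have e1 := extensionMap_ae hd γ hδ hΩ u
  have e2 := extensionMap_ae hd γ hδ hΩ (-u)
  rw [map_neg] at e2
  refine eq_zero_of_extensionMap hd γ hδ hΩ u (Lp.ext ?_)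
  filter_upwards [h1, h2, e1, e2, Lp.coeFn_neg (extensionMap hd γ hδ hΩ u),
    Lp.coeFn_zero ℝ 2 (volume : Measure (Space d))] with x a1 a2 a3 a4 a5 a6
  rw [a6, Pi.zero_apply]
  rw [← a3] at a1
  rw [← a4, a5, Pi.neg_apply] at a2
  linarith

end MaximumPrinciple

/-! ### Unique solvability of the two models -/

section WellPosed

variable (hd : 0 < d) (γ : DiffusionKernel d) {δ : ℝ} (hδ : 0 < δ) {Ω : Set (Space d)}
  (hΩ : IsOpen Ω)

/-- Unique solvability for an odd drift kernel, which is skew. -/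
theorem isUniquelySolvable_of_odd (hΩb : Bornology.IsBounded Ω) {ε : ℝ} (hε : 0 < ε) {C : ℝ}
    {q : Space d → ℝ} (hqm : Measurable q)
    (hq : IsDrift C fun p : Space d × Space d => q (p.2 - p.1)) (hodd : ∀ z, q (-z) = -q z) :
    IsUniquelySolvable (fun u => ‖energyMap hd γ hδ hΩ u‖) (driftForm hd γ hδ hΩ ε hq) := by
  obtain ⟨B, hB⟩ := exists_driftForm_bound hd γ hδ hΩ hΩb ε hq
  refine isUniquelySolvable_of_coercive _ (energyMap_injective hd γ hδ hΩ hΩb)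
    (isClosed_range_energyMap hd γ hδ hΩ hΩb) _ hB hε fun u => ?_
  rw [driftForm_apply, integral_odd_drift_eq_zero (isSingularKernel_cutKernel hd γ hδ) hqm hq hodd
    (isAdmissible_zeroExt hd γ hδ hΩ u), add_zero, norm_energyMap_sq]
  simp_rw [pow_two]
  exact le_rfl

/-- Unique solvability for a non-positive drift, by the maximum principle and the Fredholm
alternative. -/
theorem isUniquelySolvable_of_nonpos (hΩb : Bornology.IsBounded Ω) {ε : ℝ} (hε : 0 < ε) {C : ℝ}
    {q : Space d × Space d → ℝ} (hq : IsDrift C q) (hq0 : ∀ p, q p ≤ 0) :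
    IsUniquelySolvable (fun u => ‖energyMap hd γ hδ hΩ u‖) (driftForm hd γ hδ hΩ ε hq) := by
  obtain ⟨B, hB⟩ := exists_driftForm_bound hd γ hδ hΩ hΩb ε hq
  obtain ⟨n, φ, ψ, hφ, hψ, hcoer⟩ := exists_finiteRank_coercive hd γ hδ hΩ hΩb hε hq hq0
  exact isUniquelySolvable_of_finiteRank _ (energyMap_injective hd γ hδ hΩ hΩb)
    (isClosed_range_energyMap hd γ hδ hΩ hΩb) _ hB φ ψ hφ hψ (half_pos hε) hcoer
    (eq_zero_of_driftForm_eq_zero hd γ hδ hΩ hΩb hε hq hq0)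

end WellPosed

/-- The drift coefficient of the central model. -/
theorem exists_drift_of_central {δ : ℝ} {b : Space d → Space d} {H : Space d → Set (Space d)}
    {η : ℝ} (h : IsCentralModel δ b H η) :
    ∃ (C : ℝ) (q : Space d → ℝ), Measurable q ∧
      IsDrift C (fun p : Space d × Space d => q (p.2 - p.1)) ∧ (∀ z, q (-z) = -q z) ∧
      ∀ x y, q (y - x) = (H x).indicator (fun y => η⁻¹ * ⟪b x, y - x⟫) y := by
  obtain ⟨b₀, hb₀⟩ := h.velocity
  have hm : Measurable ((Metric.ball (0 : Space d) δ).indicator fun z => ⟪b₀, z⟫) :=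
    (measurable_const.inner measurable_id).indicator Metric.isOpen_ball.measurableSet
  refine ⟨‖b₀‖, _, hm, ⟨hm.comp (measurable_snd.sub measurable_fst), fun p => ?_⟩, fun z => ?_,
    fun x y => ?_⟩
  · by_cases hp : p.2 - p.1 ∈ Metric.ball (0 : Space d) δ
    · rw [indicator_of_mem hp]
      exact abs_real_inner_le_norm _ _
    · rw [indicator_of_notMem hp, abs_zero]
      positivity
  · by_cases hz : ‖z‖ < δ <;> simp [hz]
  · rw [h.region, h.fraction, hb₀]
    by_cases hy : ‖y - x‖ < δ <;> simp [hy, dist_eq_norm]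

/-- The drift coefficient of the upwind model. -/
theorem exists_drift_of_upwind {γ : DiffusionKernel d} {δ : ℝ} {Ω : Set (Space d)}
    {b : Space d → Space d} {H : Space d → Set (Space d)} {η : ℝ}
    (h : IsUpwindModel γ δ Ω b H η) :
    ∃ (C : ℝ) (q : Space d × Space d → ℝ), IsDrift C q ∧ (∀ p, q p ≤ 0) ∧
      ∀ᵐ x : Space d, ∀ y, q (x, y) = (H x).indicator (fun y => η⁻¹ * ⟪b x, y - x⟫) y := by
  obtain ⟨g, hg, hbg⟩ := h.velocity.1
  set B := (eLpNorm b ∞ volume).toReal with hB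
  have hbB : ∀ᵐ x : Space d, ‖b x‖ ≤ B := by
    filter_upwards [ae_le_eLpNormEssSup (f := b) (μ := volume)] with x hx
    rw [← eLpNorm_exponent_top] at hx
    rw [hB, ← toReal_enorm]
    exact ENNReal.toReal_mono h.velocity.2.ne hx
  -- The velocity b is only almost everywhere equal to a measurable g and only almost everywhere
  -- bounded by B. Cutting off where ‖g‖ > B gives a coefficient that is measurable and satisfies
  -- the drift bound at every pair.
  let S : Set (Space d × Space d) := {p | ‖g p.1‖ ≤ B ∧ ‖p.2 - p.1‖ < δ}
  have hS : MeasurableSet S :=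
    (measurableSet_le (hg.measurable.comp measurable_fst).norm measurable_const).inter
      (measurableSet_near δ)
  have hm : Measurable fun p : Space d × Space d => 2 * min ⟪g p.1, p.2 - p.1⟫ 0 :=
    (((hg.measurable.comp measurable_fst).inner (measurable_snd.sub measurable_fst)).min
      measurable_const).const_mul 2
  -- The factor 2 is η⁻¹, and the minimum with 0 restricts to the upwind half ball, where the inner
  -- product is negative; hence q ≤ 0.
  refine ⟨2 * B, S.indicator fun p => 2 * min ⟪g p.1, p.2 - p.1⟫ 0,
    ⟨hm.indicator hS, fun p => ?_⟩, fun p => ?_, ?_⟩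
  · by_cases hp : p ∈ S
    · rw [indicator_of_mem hp, abs_mul, abs_two, mul_assoc]
      refine mul_le_mul_of_nonneg_left ?_ zero_le_two
      have h1 : |min ⟪g p.1, p.2 - p.1⟫ 0| ≤ |⟪g p.1, p.2 - p.1⟫| := by
        rcases le_total ⟪g p.1, p.2 - p.1⟫ 0 with h0 | h0
        · rw [min_eq_left h0]
        · rw [min_eq_right h0, abs_zero]
          exact abs_nonneg _
      exact h1.trans ((abs_real_inner_le_norm _ _).trans
        (mul_le_mul_of_nonneg_right hp.1 (norm_nonneg _)))
    · rw [indicator_of_notMem hp, abs_zero]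
      have : 0 ≤ B := ENNReal.toReal_nonneg
      positivity
  · exact indicator_nonpos (fun p _ => mul_nonpos_of_nonneg_of_nonpos zero_le_two
      (min_le_right _ _)) p
  · filter_upwards [hbg, hbB] with x hx hxB y
    have hxS : (x, y) ∈ S ↔ ‖y - x‖ < δ := by
      change ‖g x‖ ≤ B ∧ ‖y - x‖ < δ ↔ _
      rw [← hx, and_iff_right hxB]
    have hHx : y ∈ H x ↔ ‖y - x‖ < δ ∧ 0 < -⟪b x, y - x⟫ := by
      rw [h.region, ← dist_eq_norm]
      rfl
    classical
    rw [indicator_apply, indicator_apply, h.fraction]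
    simp only [hxS, hHx, ← hx, one_div, inv_inv]
    by_cases h1 : ‖y - x‖ < δ
    · rcases lt_or_ge ⟪b x, y - x⟫ 0 with h2 | h2
      · simp [h1, h2, min_eq_left h2.le]
      · simp [h1, not_lt.2 h2, min_eq_right h2]
    · simp [h1]

/-- The two models lead to a uniquely solvable form given by a drift coefficient. -/
theorem exists_solvable_driftForm (hd : 0 < d) (γ : DiffusionKernel d) {δ : ℝ} (hδ : 0 < δ)
    {Ω : Set (Space d)} (hΩ : IsOpen Ω) (hΩb : Bornology.IsBounded Ω) (b : Space d → Space d)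
    (H : Space d → Set (Space d)) (η : ℝ)
    (hmodel : IsCentralModel δ b H η ∨ IsUpwindModel γ δ Ω b H η) {ε : ℝ} (hε : 0 < ε) :
    ∃ B : energySpace γ δ Ω →ₗ[ℝ] energySpace γ δ Ω →ₗ[ℝ] ℝ,
      (∀ u v, convDiffForm γ δ Ω b H η ε u v = B u v) ∧
      (∃ D, ∀ u v, |B u v| ≤ D * ‖energyMap hd γ hδ hΩ u‖ * ‖energyMap hd γ hδ hΩ v‖) ∧
      IsUniquelySolvable (fun u => ‖energyMap hd γ hδ hΩ u‖) B := by
  rcases hmodel with h | h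
  · obtain ⟨C, q, hqm, hq, hodd, hqb⟩ := exists_drift_of_central h
    refine ⟨driftForm hd γ hδ hΩ ε hq, fun u v => convDiffForm_eq_driftForm hd γ hδ hΩ ε
      (fun x => (h.region x).le) (fun x => ?_) hq (ae_of_all _ hqb) u v,
      exists_driftForm_bound hd γ hδ hΩ hΩb ε hq,
      isUniquelySolvable_of_odd hd γ hδ hΩ hΩb hε hqm hq hodd⟩
    rw [h.region]
    exact Metric.isOpen_ball.measurableSet
  · obtain ⟨C, q, hq, hq0, hqb⟩ := exists_drift_of_upwind h
    refine ⟨driftForm hd γ hδ hΩ ε hq, fun u v => convDiffForm_eq_driftForm hd γ hδ hΩ ε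
      (fun x => ?_) (fun x => ?_) hq (ae_restrict_of_ae hqb) u v,
      exists_driftForm_bound hd γ hδ hΩ hΩb ε hq,
      isUniquelySolvable_of_nonpos hd γ hδ hΩ hΩb hε hq hq0⟩
    · rw [h.region]
      exact fun y hy => hy.1
    · have hm : MeasurableSet {y | 0 < -⟪b x, y - x⟫} := measurableSet_lt measurable_const
        (measurable_const.inner (measurable_id.sub_const x)).neg
      rw [h.region]
      exact Metric.isOpen_ball.measurableSet.inter hm

end NonlocalCD

theorem mainTheorem1 {d : ℕ} (hd : 0 < d) (γ : NonlocalCD.DiffusionKernel d)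
    {Ω : Set (NonlocalCD.Space d)} (hΩ : IsOpen Ω) (hΩb : Bornology.IsBounded Ω)
    {δ : ℝ} (hδ : 0 < δ) (b : NonlocalCD.Space d → NonlocalCD.Space d)
    (H : NonlocalCD.Space d → Set (NonlocalCD.Space d)) (η : ℝ)
    (hmodel : NonlocalCD.IsCentralModel δ b H η ∨ NonlocalCD.IsUpwindModel γ δ Ω b H η)
    {ε : ℝ} (hε : 0 < ε) :
    NonlocalCD.IsNorm (NonlocalCD.energyNorm γ δ Ω) ∧
    (∀ v, BddAbove (Set.range (NonlocalCD.optimalQuotient γ δ Ω b H η ε v))) ∧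
    NonlocalCD.IsNorm (NonlocalCD.optimalNorm γ δ Ω b H η ε) ∧
    ∀ f : NonlocalCD.energySpace γ δ Ω →ₗ[ℝ] ℝ,
      NonlocalCD.IsBoundedFunctional (NonlocalCD.optimalNorm γ δ Ω b H η ε) f →
      ∃ u : NonlocalCD.energySpace γ δ Ω,
        (∀ v, NonlocalCD.convDiffForm γ δ Ω b H η ε u v = f v) ∧
        (∀ w : NonlocalCD.energySpace γ δ Ω,
          (∀ v, NonlocalCD.convDiffForm γ δ Ω b H η ε w v = f v) → w = u) ∧
        NonlocalCD.energyNorm γ δ Ω u =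
          NonlocalCD.dualNorm (NonlocalCD.optimalNorm γ δ Ω b H η ε) f := by
  obtain ⟨B, hB, ⟨D, hD⟩, hsol⟩ :=
    NonlocalCD.exists_solvable_driftForm hd γ hδ hΩ hΩb b H η hmodel hε
  exact NonlocalCD.wellPosed_of_isUniquelySolvable _ (NonlocalCD.energyMap_injective hd γ hδ hΩ hΩb)
    (NonlocalCD.isClosed_range_energyMap hd γ hδ hΩ hΩb) B hD hsol
    (NonlocalCD.energyNorm_eq hd γ hδ hΩ) hB
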